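/- Let $n>2$ and let $w\in\mathfrak S_n$ be a permutation, written in one-line notation $w(1)w(2)\cdots w(n)$, such that $\{w(1),\dots,w(r)\}\ne\{1,\dots,r\}$ for all $1\le r<n$. Elnitsky's polygon $X(w)$ is the equilateral $2n$-gon whose sides, starting at the topmost vertex and going counterclockwise, are labeled $1,\dots,n,w(n),\dots,w(1)$, where the sides $1,\dots,n$ on the left, which run from the topmost to the bottommost vertex, form half of a convex $2n$-gon, and where two sides are parallel if and only if they have the same label. (The angles are otherwise arbitrary.) A rhombic tiling of $X(w)$ is a tiling of the region enclosed by $X(w)$ by rhombi all of whose edges are congruent and parallel to sides of $X(w)$; it is discrete, in the sense that two tile edges, or a tile edge and a side of $X(w)$, that meet in more than one point coincide. A tile is a perimeter tile if it shares with the boundary of $X(w)$ a path consisting of at least two tile edges, i.e. if two adjacent edges of the tile are sides of $X(w)$. Then every rhombic tiling of $X(w)$ has exactly two perimeter tiles if and only if $$w=n\,1\,2\,3\cdots(n-1)\qquad\text{or}\qquad w=2\,3\,4\cdots n\,1 .$$ -/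

import Mathlib

namespace Elnitsky

noncomputable section

/-- The unit vector in the direction `θ a`, in the plane `ℂ`: the direction, traversed downwards,
of the sides labeled `a`. Labels are `0, …, n - 1` instead of `1, …, n`. -/
def dir {n : ℕ} (θ : Fin n → ℝ) (a : Fin n) : ℂ :=
  ⟨Real.cos (θ a), Real.sin (θ a)⟩

/-- Admissible directions: all of them point strictly downwards, and they turn counterclockwise as
the label increases. Equivalently, the unit sides with directions `θ 0, θ 1, …`, drawn one after
the other, run down the left half of a convex centrally symmetric `2n`-gon. -/
def IsAdmissible {n : ℕ} (θ : Fin n → ℝ) : Prop :=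
  StrictMono θ ∧ ∀ a, θ a ∈ Set.Ioo Real.pi (2 * Real.pi)

/-- The vertex number `k` (from the top, which is placed at the origin) of the descending path
whose sides are labeled `σ 0, σ 1, …` from top to bottom. -/
def pathVertex {n : ℕ} (θ : Fin n → ℝ) (σ : Equiv.Perm (Fin n)) (k : ℕ) : ℂ :=
  ∑ i : Fin n with i.val < k, dir θ (σ i)

/-- The `i`-th side (from the top) of the descending path with labels `σ 0, σ 1, …`. -/
def pathSide {n : ℕ} (θ : Fin n → ℝ) (σ : Equiv.Perm (Fin n)) (i : Fin n) : Set ℂ :=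
  segment ℝ (pathVertex θ σ i.val) (pathVertex θ σ (i.val + 1))

/-- The leftside boundary of `X(w)`: its labels are `0, 1, …, n - 1` from top to bottom. -/
def leftside {n : ℕ} (θ : Fin n → ℝ) : Set ℂ :=
  ⋃ i : Fin n, pathSide θ 1 i

/-- The rightside boundary of `X(w)`: its labels are `w 0, w 1, …, w (n - 1)` from top to
bottom. -/
def rightside {n : ℕ} (θ : Fin n → ℝ) (w : Equiv.Perm (Fin n)) : Set ℂ :=
  ⋃ i : Fin n, pathSide θ w i

/-- The set of the `2n` sides of `X(w)`. -/
def polygonSides {n : ℕ} (θ : Fin n → ℝ) (w : Equiv.Perm (Fin n)) : Set (Set ℂ) :=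
  Set.range (pathSide θ 1) ∪ Set.range (pathSide θ w)

/-- The closed region `X(w)`. Both boundary paths descend strictly from the common top vertex to
the common bottom vertex, so the region that they enclose consists of the points that lie, at
their height, between the leftside and the rightside boundary. -/
def region {n : ℕ} (θ : Fin n → ℝ) (w : Equiv.Perm (Fin n)) : Set ℂ :=
  {z | ∃ x ∈ leftside θ, ∃ y ∈ rightside θ w,
    x.im = z.im ∧ y.im = z.im ∧ x.re ≤ z.re ∧ z.re ≤ y.re}

/-- No proper nonempty initial segment of positions is mapped to itself, that is
`{w(1), …, w(r)} ≠ {1, …, r}` for `1 ≤ r < n`; then the interior of `X(w)` is connected. -/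
def IsContiguous {n : ℕ} (w : Equiv.Perm (Fin n)) : Prop :=
  ∀ r : ℕ, 0 < r → r < n → w '' {i | i.val < r} ≠ {i | i.val < r}

/-- A rhombus whose sides are congruent and parallel to sides of `X(w)`. It is determined by its
topmost vertex and by its two edge labels `a < b`. -/
structure Tile (n : ℕ) where
  /-- the topmost vertex -/
  apex : ℂ
  /-- the smaller edge label -/
  a : Fin n
  /-- the larger edge label -/
  b : Fin n
  lt : a < b

/-- The closed rhombus. -/
def Tile.carrier {n : ℕ} (θ : Fin n → ℝ) (t : Tile n) : Set ℂ :=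
  {z | ∃ x ∈ Set.Icc (0 : ℝ) 1, ∃ y ∈ Set.Icc (0 : ℝ) 1,
    z = t.apex + x • dir θ t.a + y • dir θ t.b}

/-- The set of the four edges of the rhombus. -/
def Tile.edges {n : ℕ} (θ : Fin n → ℝ) (t : Tile n) : Set (Set ℂ) :=
  {segment ℝ t.apex (t.apex + dir θ t.a),
   segment ℝ t.apex (t.apex + dir θ t.b),
   segment ℝ (t.apex + dir θ t.a) (t.apex + dir θ t.a + dir θ t.b),
   segment ℝ (t.apex + dir θ t.b) (t.apex + dir θ t.a + dir θ t.b)}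

/-- `T` is a rhombic tiling of `X(w)`: the rhombi in `T` have pairwise disjoint interiors and their
union is `X(w)`. The tiling is discrete: edges (of tiles, or of a tile and of the polygon) that
meet in more than one point coincide. -/
structure IsRhombicTiling {n : ℕ} (θ : Fin n → ℝ) (w : Equiv.Perm (Fin n))
    (T : Finset (Tile n)) : Prop where
  disjoint : ∀ t ∈ T, ∀ u ∈ T, t ≠ u → Disjoint (interior (t.carrier θ)) (interior (u.carrier θ))
  cover : ⋃ t ∈ T, t.carrier θ = region θ w
  discrete : ∀ t ∈ T, ∀ u ∈ T, ∀ E ∈ t.edges θ, ∀ F ∈ u.edges θ, (E ∩ F).Nontrivial → E = F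
  discrete_boundary : ∀ t ∈ T, ∀ E ∈ t.edges θ, ∀ F ∈ polygonSides θ w,
    (E ∩ F).Nontrivial → E = F

/-- A (strong) perimeter tile: it shares with the boundary of `X(w)` a path of length at least two,
that is, two distinct edges of the tile with a common point are sides of `X(w)`. -/
def IsPerimeterTile {n : ℕ} (θ : Fin n → ℝ) (w : Equiv.Perm (Fin n)) (t : Tile n) : Prop :=
  ∃ E ∈ t.edges θ, ∃ F ∈ t.edges θ, E ≠ F ∧ (E ∩ F).Nonempty ∧
    E ∈ polygonSides θ w ∧ F ∈ polygonSides θ w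

/-- The number of perimeter tiles of `T`. -/
def perim {n : ℕ} (θ : Fin n → ℝ) (w : Equiv.Perm (Fin n)) (T : Finset (Tile n)) : ℕ :=
  Set.ncard {t | t ∈ T ∧ IsPerimeterTile θ w t}

/-- The permutation with one-line notation `n 1 2 ⋯ (n - 1)`. -/
def IsLastFirst {n : ℕ} (w : Equiv.Perm (Fin n)) : Prop :=
  ∀ i : Fin n, (w i).val = if i.val = 0 then n - 1 else i.val - 1

/-- The permutation with one-line notation `2 3 ⋯ n 1`. -/
def IsFirstLast {n : ℕ} (w : Equiv.Perm (Fin n)) : Prop :=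
  ∀ i : Fin n, (w i).val = if i.val = n - 1 then 0 else i.val + 1

end

end Elnitsky

/-! Tilings come from sweeping a descending path across the polygon. Exchanging two adjacent labels
that stand in increasing order pushes the path over one rhombus and adds one inversion, so a chain
of such flips from the identity to `w` sweeps out a set of rhombi. These fill the region
(`Sweep.betw_eq`) and meet discretely (`pathSide_eq_of_nontrivial`), hence form a tiling
(`Sweep.isRhombicTiling`). The first flip uses two consecutive left sides and the last one two
consecutive right sides, so each contributes a perimeter tile.

Let `w` be non-exceptional, with labels and positions counted from 0. A chain is chosen with a third
perimeter tile in between. If `w 0 ≠ 1` and `w 1 ≠ 0`, a maximal path below `w` starting with label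
0 continues with `w 0`, and the next flip sweeps a tile at the top vertex
(`IsContiguous.exists_tiling_apex`). If `w 0 = 1`, contiguity yields labels `k, k + 1` with `k ≥ 2`
that are inverted in `w`, and two independent left corners can be swept first
(`IsContiguous.exists_tiling_left`). If `w 1 = 0`, two independent right corners can be swept last
(`IsContiguous.exists_tiling_right`).

For an exceptional `w`, one label `ℓ` crosses all others, which keep their order, so the polygon is
a strip of `n - 1` rhombi stacked along edges labeled `ℓ`. Discreteness forces an arbitrary tiling
to follow the strip tile by tile from one end (`Strip.tile_mem`), so the tiling is unique
(`Strip.mem_iff`). Only the two end tiles touch the boundary along adjacent edges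
(`Strip.isPerimeterTile_iff`). -/

namespace Elnitsky

open Equiv

/-! ### The weak order and adjacent flips -/

/-- The weak order on permutations: containment of inversion sets. -/
def WeakLE {n : ℕ} (σ τ : Perm (Fin n)) : Prop :=
  ∀ a b, a < b → σ.symm b < σ.symm a → τ.symm b < τ.symm a

lemma WeakLE.refl {n : ℕ} (σ : Perm (Fin n)) : WeakLE σ σ := fun _ _ _ h => h

lemma WeakLE.trans {n : ℕ} {σ τ ρ : Perm (Fin n)} (h : WeakLE σ τ) (h' : WeakLE τ ρ) :
    WeakLE σ ρ := fun a b hab hi => h' a b hab (h a b hab hi)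

lemma one_weakLE {n : ℕ} (σ : Perm (Fin n)) : WeakLE 1 σ := fun _ _ hab h =>
  absurd h (not_lt.2 hab.le)

lemma swap_lt_swap {n : ℕ} {i j x y : Fin n} (hij : i.val + 1 = j.val) (hxy : x < y)
    (h : ¬(x = i ∧ y = j)) : swap i j x < swap i j y := by
  simp only [swap_apply_def, Fin.lt_def, Fin.ext_iff] at *
  split_ifs <;> omega

lemma flip_symm_apply {n : ℕ} (σ : Perm (Fin n)) (i j a : Fin n) :
    (σ * swap i j).symm a = swap i j (σ.symm a) := by
  rw [Equiv.symm_apply_eq]; simp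

/-- No position lies between `i` and `j = i + 1`, so the exchange alters the relative order of one
pair only: a flip adds exactly one inversion. -/
lemma flip_inv_iff {n : ℕ} {σ : Perm (Fin n)} {i j : Fin n} (hij : i.val + 1 = j.val)
    (hlt : σ i < σ j) {a b : Fin n} (hab : a < b) :
    (σ * swap i j).symm b < (σ * swap i j).symm a ↔
      σ.symm b < σ.symm a ∨ (a = σ i ∧ b = σ j) := by
  rw [flip_symm_apply, flip_symm_apply]
  constructor
  · intro h
    by_contra! hc
    obtain ⟨h1, h2⟩ := hc
    have h3 : σ.symm a < σ.symm b := lt_of_le_of_ne h1 (fun e => hab.ne (σ.symm.injective e))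
    refine (swap_lt_swap hij h3 ?_).not_gt h
    rintro ⟨ha, hb⟩
    exact h2 (by rw [← ha]; simp) (by rw [← hb]; simp)
  · rintro (h | ⟨rfl, rfl⟩)
    · refine swap_lt_swap hij h ?_
      rintro ⟨hb, ha⟩
      rw [← hb, ← ha] at hlt
      simp only [apply_symm_apply] at hlt
      exact hlt.not_gt hab
    · simp only [symm_apply_apply, swap_apply_left, swap_apply_right]
      exact Fin.lt_def.2 (by omega)

lemma weakLE_flip {n : ℕ} {σ : Perm (Fin n)} {i j : Fin n} (hij : i.val + 1 = j.val)
    (hlt : σ i < σ j) : WeakLE σ (σ * swap i j) := fun _ _ hab h =>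
  (flip_inv_iff hij hlt hab).2 (Or.inl h)

lemma flip_weakLE {n : ℕ} {σ τ : Perm (Fin n)} {i j : Fin n} (hij : i.val + 1 = j.val)
    (hlt : σ i < σ j) (h : WeakLE σ τ) (hτ : τ.symm (σ j) < τ.symm (σ i)) :
    WeakLE (σ * swap i j) τ := fun a b hab hi => by
  rcases (flip_inv_iff hij hlt hab).1 hi with h1 | ⟨rfl, rfl⟩
  exacts [h a b hab h1, hτ]

lemma perm_eq_one_of_lt_succ {n : ℕ} (ρ : Perm (Fin n))
    (h : ∀ i j : Fin n, i.val + 1 = j.val → ρ i < ρ j) : ρ = 1 := by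
  have hm : StrictMono ρ := by
    cases n with
    | zero => exact fun i => i.elim0
    | succ m => exact Fin.strictMono_iff_lt_succ.2 fun i => h _ _ (by simp)
  have := (StrictMono.range_inj hm strictMono_id).1 (by simp [ρ.surjective.range_eq])
  ext i
  simp [this]

/-- Otherwise `τ⁻¹σ` increases at every step: at ascents of `σ` because no flip is available, at
descents because inversions of `σ` are inversions of `τ`. An increasing permutation is the identity.
-/
lemma exists_flip {n : ℕ} {σ τ : Perm (Fin n)} (h : WeakLE σ τ) (hne : σ ≠ τ) :
    ∃ i j : Fin n, i.val + 1 = j.val ∧ σ i < σ j ∧ τ.symm (σ j) < τ.symm (σ i) := by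
  by_contra! hc
  apply hne
  have := perm_eq_one_of_lt_succ (τ.symm * σ : Perm (Fin n)) (fun i j hij => by
    simp only [Perm.mul_apply]
    have hne : i ≠ j := fun e => by simp [e] at hij
    rcases lt_or_gt_of_ne (σ.injective.ne hne) with h1 | h1
    · exact lt_of_le_of_ne (hc i j hij h1) (by simpa using hne)
    · exact h _ _ h1 (by simpa using Fin.lt_def.2 (by omega : i.val < j.val)))
  ext i
  have h2 := congrArg (fun ρ : Perm (Fin n) => τ (ρ i)) this
  simp at h2
  rw [h2]

/-- The number of non-inversions. -/
def coinv {n : ℕ} (σ : Perm (Fin n)) : ℕ :=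
  (Finset.univ.filter fun p : Fin n × Fin n => p.1 < p.2 ∧ ¬ σ.symm p.2 < σ.symm p.1).card

lemma coinv_flip_lt {n : ℕ} {σ : Perm (Fin n)} {i j : Fin n} (hij : i.val + 1 = j.val)
    (hlt : σ i < σ j) : coinv (σ * swap i j) < coinv σ := by
  apply Finset.card_lt_card
  refine (Finset.ssubset_iff_of_subset ?_).2 ⟨(σ i, σ j), ?_, ?_⟩
  · intro p hp
    simp only [Finset.mem_filter, Finset.mem_univ, true_and] at hp ⊢
    exact ⟨hp.1, fun h => hp.2 (weakLE_flip hij hlt _ _ hp.1 h)⟩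
  · simp only [Finset.mem_filter, Finset.mem_univ, true_and, symm_apply_apply]
    exact ⟨hlt, fun h => absurd (Fin.lt_def.1 h) (by omega)⟩
  · simp only [Finset.mem_filter, Finset.mem_univ, true_and, not_and, not_not]
    exact fun _ => (flip_inv_iff hij hlt hlt).2 (Or.inr ⟨rfl, rfl⟩)

noncomputable section

/-! ### Sweeps -/

/-- The tile swept when the labels at the positions `i`, `j = i + 1` of a path are exchanged. -/
def flipTile {n : ℕ} (θ : Fin n → ℝ) (σ : Perm (Fin n)) (i j : Fin n) (h : σ i < σ j) : Tile n :=
  ⟨pathVertex θ σ i.val, σ i, σ j, h⟩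

/-- `Sweep θ σ τ T`: the path `σ` can be moved to the path `τ` by exchanging adjacent labels in
increasing order; `T` is the set of the tiles that are swept. -/
inductive Sweep {n : ℕ} (θ : Fin n → ℝ) :
    Perm (Fin n) → Perm (Fin n) → Set (Tile n) → Prop
  | refl (σ : Perm (Fin n)) : Sweep θ σ σ ∅
  | flip (σ : Perm (Fin n)) (i j : Fin n) (hij : i.val + 1 = j.val) (h : σ i < σ j) :
      Sweep θ σ (σ * swap i j) {flipTile θ σ i j h}
  | trans {σ τ ρ : Perm (Fin n)} {T U : Set (Tile n)} :
      Sweep θ σ τ T → Sweep θ τ ρ U → Sweep θ σ ρ (T ∪ U)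

lemma Sweep.weakLE {n : ℕ} {θ : Fin n → ℝ} {σ τ : Perm (Fin n)} {T : Set (Tile n)}
    (h : Sweep θ σ τ T) : WeakLE σ τ := by
  induction h with
  | refl σ => exact WeakLE.refl σ
  | flip σ i j hij h => exact weakLE_flip hij h
  | trans _ _ h1 h2 => exact h1.trans h2

lemma Sweep.finite {n : ℕ} {θ : Fin n → ℝ} {σ τ : Perm (Fin n)} {T : Set (Tile n)}
    (h : Sweep θ σ τ T) : T.Finite := by
  induction h with
  | refl σ => exact Set.finite_empty
  | flip σ i j hij h => exact Set.finite_singleton _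
  | trans _ _ h1 h2 => exact h1.union h2

/-- Greedy choice: `exists_flip` supplies a flip that stays below `τ`, and each flip lowers `coinv`.
-/
lemma exists_sweep {n : ℕ} (θ : Fin n → ℝ) {σ τ : Perm (Fin n)} (h : WeakLE σ τ) :
    ∃ T, Sweep θ σ τ T := by
  induction hk : coinv σ using Nat.strong_induction_on generalizing σ with
  | _ k ih =>
    by_cases hne : σ = τ
    · exact hne ▸ ⟨_, Sweep.refl σ⟩
    · obtain ⟨i, j, hij, hlt, hτ⟩ := exists_flip h hne
      obtain ⟨T, hT⟩ := ih _ (hk ▸ coinv_flip_lt hij hlt) (flip_weakLE hij hlt h hτ) rfl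
      exact ⟨_, (Sweep.flip σ i j hij hlt).trans hT⟩

/-- A swept tile comes from a flip between the two ends of the sweep. -/
lemma Sweep.exists_of_mem {n : ℕ} {θ : Fin n → ℝ} {σ τ : Perm (Fin n)} {T : Set (Tile n)}
    (h : Sweep θ σ τ T) {t : Tile n} (ht : t ∈ T) :
    ∃ (ρ : Perm (Fin n)) (i j : Fin n) (_ : i.val + 1 = j.val) (hlt : ρ i < ρ j),
      WeakLE σ ρ ∧ WeakLE (ρ * swap i j) τ ∧ t = flipTile θ ρ i j hlt := by
  induction h with
  | refl σ => exact ht.elim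
  | flip σ i j hij h => exact ⟨σ, i, j, hij, h, .refl _, .refl _, ht⟩
  | trans h1 h2 ih1 ih2 =>
    rcases ht with ht | ht
    · obtain ⟨ρ, i, j, hij, hlt, ha, hb, hc⟩ := ih1 ht
      exact ⟨ρ, i, j, hij, hlt, ha, hb.trans h2.weakLE, hc⟩
    · obtain ⟨ρ, i, j, hij, hlt, ha, hb, hc⟩ := ih2 ht
      exact ⟨ρ, i, j, hij, hlt, h1.weakLE.trans ha, hb, hc⟩

/-- The labels of a swept tile are inverted at the end of the sweep, but not at its start. -/
lemma Sweep.inv_of_mem {n : ℕ} {θ : Fin n → ℝ} {σ τ : Perm (Fin n)} {T : Set (Tile n)}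
    (h : Sweep θ σ τ T) {t : Tile n} (ht : t ∈ T) :
    ¬ σ.symm t.b < σ.symm t.a ∧ τ.symm t.b < τ.symm t.a := by
  obtain ⟨ρ, i, j, hij, hlt, ha, hb, rfl⟩ := h.exists_of_mem ht
  refine ⟨fun hi => ?_, hb _ _ hlt ((flip_inv_iff hij hlt hlt).2 (Or.inr ⟨rfl, rfl⟩))⟩
  have := ha _ _ hlt hi
  simp only [symm_apply_apply, Fin.lt_def] at this
  omega

lemma Sweep.exists_of_inv {n : ℕ} {θ : Fin n → ℝ} {σ τ : Perm (Fin n)} {T : Set (Tile n)}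
    (h : Sweep θ σ τ T) {a b : Fin n} (hab : a < b) (hσ : ¬ σ.symm b < σ.symm a)
    (hτ : τ.symm b < τ.symm a) : ∃ t ∈ T, t.a = a ∧ t.b = b := by
  induction h with
  | refl σ => exact absurd hτ hσ
  | flip σ i j hij h =>
    rcases (flip_inv_iff hij h hab).1 hτ with h1 | ⟨rfl, rfl⟩
    exacts [absurd h1 hσ, ⟨_, rfl, rfl, rfl⟩]
  | @trans σ τ ρ T U h1 h2 ih1 ih2 =>
    by_cases hc : τ.symm b < τ.symm a
    · obtain ⟨t, ht, h⟩ := ih1 hσ hc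
      exact ⟨t, Or.inl ht, h⟩
    · obtain ⟨t, ht, h⟩ := ih2 hc hτ
      exact ⟨t, Or.inr ht, h⟩


/-! ### Cross products, directions and segments -/

/-- The cross product of two vectors of the plane. -/
def cr (u v : ℂ) : ℝ := u.re * v.im - u.im * v.re

lemma cr_add (u v w : ℂ) : cr u (v + w) = cr u v + cr u w := by simp [cr]; ring
lemma cr_neg (u v : ℂ) : cr u (-v) = -cr u v := by simp [cr]; ring
lemma cr_smul (u v : ℂ) (t : ℝ) : cr u (t • v) = t * cr u v := by simp [cr]; ring
lemma cr_self (u : ℂ) : cr u u = 0 := by simp [cr]; ring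
lemma cr_zero (u : ℂ) : cr u 0 = 0 := by simp [cr]
lemma cr_swap (u v : ℂ) : cr u v = -cr v u := by simp [cr]; ring
lemma cr_sum {ι : Type*} (u : ℂ) (s : Finset ι) (f : ι → ℂ) :
    cr u (∑ i ∈ s, f i) = ∑ i ∈ s, cr u (f i) := by
  classical
  induction s using Finset.induction_on with
  | empty => simp [cr_zero]
  | insert a s ha ih => rw [Finset.sum_insert ha, Finset.sum_insert ha, cr_add, ih]

section dir

variable {n : ℕ} {θ : Fin n → ℝ}

lemma IsAdmissible.dir_im_neg (hθ : IsAdmissible θ) (a : Fin n) : (dir θ a).im < 0 := by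
  have h := hθ.2 a
  have := Real.sin_neg_of_neg_of_neg_pi_lt (x := θ a - 2 * Real.pi) (by linarith [h.2])
    (by linarith [h.1])
  rw [Real.sin_sub_two_pi] at this
  exact this

lemma IsAdmissible.dir_ne_zero (hθ : IsAdmissible θ) (a : Fin n) : dir θ a ≠ 0 := fun h => by
  have := hθ.dir_im_neg a
  simp [h] at this

lemma IsAdmissible.cr_pos (hθ : IsAdmissible θ) {a b : Fin n} (h : a < b) :
    0 < cr (dir θ a) (dir θ b) := by
  have h1 := hθ.2 a
  have h2 := hθ.2 b
  have h3 := hθ.1 h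
  have := Real.sin_pos_of_pos_of_lt_pi (x := θ b - θ a) (by linarith)
    (by linarith [h1.1, h2.2])
  rw [Real.sin_sub] at this
  simp only [cr, dir]
  linarith

lemma IsAdmissible.cr_neg (hθ : IsAdmissible θ) {a b : Fin n} (h : b < a) :
    cr (dir θ a) (dir θ b) < 0 := by
  rw [cr_swap]
  linarith [hθ.cr_pos h]

lemma IsAdmissible.cr_ne (hθ : IsAdmissible θ) {a b : Fin n} (h : a ≠ b) :
    cr (dir θ a) (dir θ b) ≠ 0 := by
  rcases lt_or_gt_of_ne h with h | h
  exacts [(hθ.cr_pos h).ne', (hθ.cr_neg h).ne]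

lemma IsAdmissible.dir_injective (hθ : IsAdmissible θ) : Function.Injective (dir θ) :=
  fun a b h => by
    by_contra hne
    exact hθ.cr_ne hne (by rw [h, cr_self])

end dir

lemma mem_segment_add {P d z : ℂ} :
    z ∈ segment ℝ P (P + d) ↔ ∃ t ∈ Set.Icc (0 : ℝ) 1, z = P + t • d := by
  rw [segment_eq_image']
  simp [Set.mem_image, eq_comm]

lemma segment_unique {P d x y : ℂ} (hd : d.im < 0) (hx : x ∈ segment ℝ P (P + d))
    (hy : y ∈ segment ℝ P (P + d)) (h : x.im = y.im) : x = y := by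
  obtain ⟨s, _, rfl⟩ := mem_segment_add.1 hx
  obtain ⟨t, _, rfl⟩ := mem_segment_add.1 hy
  simp at h
  rcases h with h | h
  · rw [h]
  · exact absurd h hd.ne

lemma segment_im_bounds {P d x : ℂ} (hd : d.im < 0) (hx : x ∈ segment ℝ P (P + d)) :
    (P + d).im ≤ x.im ∧ x.im ≤ P.im := by
  obtain ⟨s, hs, rfl⟩ := mem_segment_add.1 hx
  simp
  constructor <;> nlinarith [hs.1, hs.2]

lemma segment_exists {P d : ℂ} {y : ℝ} (hd : d.im < 0) (h1 : (P + d).im ≤ y) (h2 : y ≤ P.im) :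
    ∃ x ∈ segment ℝ P (P + d), x.im = y := by
  simp only [Complex.add_im] at h1
  refine ⟨P + ((y - P.im) / d.im) • d, mem_segment_add.2 ⟨_, ⟨?_, ?_⟩, rfl⟩, ?_⟩
  · exact div_nonneg_of_nonpos (by linarith) hd.le
  · rw [div_le_one_of_neg hd]; linarith
  · simp [hd.ne]

/-- Two segments with the same downward direction that are equal start at the same point. -/
lemma segment_inj {P Q d e : ℂ} (hd : d.im < 0) (he : e.im < 0)
    (h : segment ℝ P (P + d) = segment ℝ Q (Q + e)) : P = Q ∧ d = e := by
  have h1 := segment_im_bounds he (h ▸ left_mem_segment ℝ P (P + d))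
  have h2 := segment_im_bounds hd (h ▸ left_mem_segment ℝ Q (Q + e))
  have h3 := segment_im_bounds he (h ▸ right_mem_segment ℝ P (P + d))
  have h4 := segment_im_bounds hd (h ▸ right_mem_segment ℝ Q (Q + e))
  have hPQ : P = Q := segment_unique hd (left_mem_segment ℝ P (P + d))
    (h ▸ left_mem_segment ℝ Q (Q + e)) (by linarith)
  have hd' := segment_unique hd (right_mem_segment ℝ P (P + d))
    (h ▸ right_mem_segment ℝ Q (Q + e)) (by linarith)
  exact ⟨hPQ, by rw [hPQ] at hd'; exact add_left_cancel hd'⟩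

/-! ### Descending paths, parametrized by height -/

section path

variable {n : ℕ} {θ : Fin n → ℝ}

/-- Summing over labels shows that a vertex depends only on the set of labels above it, so vertices
of different paths can be compared label by label. -/
lemma pathVertex_eq_sum (θ : Fin n → ℝ) (σ : Perm (Fin n)) (k : ℕ) :
    pathVertex θ σ k = ∑ a, if (σ.symm a).val < k then dir θ a else 0 := by
  rw [pathVertex, Finset.sum_filter]
  exact Fintype.sum_equiv σ _ _ (fun i => by simp)

lemma pathVertex_zero (θ : Fin n → ℝ) (σ : Perm (Fin n)) : pathVertex θ σ 0 = 0 := by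
  simp [pathVertex]

lemma pathVertex_succ (θ : Fin n → ℝ) (σ : Perm (Fin n)) (i : Fin n) :
    pathVertex θ σ (i.val + 1) = pathVertex θ σ i.val + dir θ (σ i) := by
  have : (Finset.univ.filter fun k : Fin n => k.val < i.val + 1) =
      insert i (Finset.univ.filter fun k : Fin n => k.val < i.val) := by
    ext k
    simp [Fin.ext_iff]
    omega
  rw [pathVertex, this, Finset.sum_insert (by simp), pathVertex, add_comm]

lemma pathSide_eq (θ : Fin n → ℝ) (σ : Perm (Fin n)) (i : Fin n) :
    pathSide θ σ i = segment ℝ (pathVertex θ σ i.val) (pathVertex θ σ i.val + dir θ (σ i)) := by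
  rw [pathSide, pathVertex_succ]

lemma pathVertex_last (θ : Fin n → ℝ) (σ τ : Perm (Fin n)) :
    pathVertex θ σ n = pathVertex θ τ n := by
  simp [pathVertex_eq_sum]

lemma pathVertex_im_lt (hθ : IsAdmissible θ) (σ : Perm (Fin n)) {i j : ℕ} (hij : i < j)
    (hj : j ≤ n) : (pathVertex θ σ j).im < (pathVertex θ σ i).im := by
  induction j with
  | zero => omega
  | succ j ih =>
    have h1 := pathVertex_succ θ σ ⟨j, hj⟩
    have h2 := hθ.dir_im_neg (σ ⟨j, hj⟩)
    simp only at h1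
    rw [h1, Complex.add_im]
    rcases (Nat.lt_succ_iff.1 hij).lt_or_eq with h | rfl
    · linarith [ih h (by omega)]
    · linarith

lemma pathVertex_im_le (hθ : IsAdmissible θ) (σ : Perm (Fin n)) {i j : ℕ} (hij : i ≤ j)
    (hj : j ≤ n) : (pathVertex θ σ j).im ≤ (pathVertex θ σ i).im := by
  rcases hij.lt_or_eq with h | rfl
  exacts [(pathVertex_im_lt hθ σ h hj).le, le_rfl]

lemma pathSide_unique (hθ : IsAdmissible θ) {σ : Perm (Fin n)} {i : Fin n} {x y : ℂ}
    (hx : x ∈ pathSide θ σ i) (hy : y ∈ pathSide θ σ i) (h : x.im = y.im) : x = y := by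
  rw [pathSide_eq] at hx hy
  exact segment_unique (hθ.dir_im_neg _) hx hy h

lemma pathSide_im_bounds (hθ : IsAdmissible θ) {σ : Perm (Fin n)} {i : Fin n} {x : ℂ}
    (hx : x ∈ pathSide θ σ i) :
    (pathVertex θ σ (i.val + 1)).im ≤ x.im ∧ x.im ≤ (pathVertex θ σ i.val).im := by
  rw [pathSide_eq] at hx
  rw [pathVertex_succ]
  exact segment_im_bounds (hθ.dir_im_neg _) hx

lemma mem_rightside {σ : Perm (Fin n)} {x : ℂ} :
    x ∈ rightside θ σ ↔ ∃ i, x ∈ pathSide θ σ i := by simp [rightside]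

lemma pathSide_unique_of_lt (hθ : IsAdmissible θ) {σ : Perm (Fin n)} {i j : Fin n} {x y : ℂ}
    (hij : i < j) (hx : x ∈ pathSide θ σ i) (hy : y ∈ pathSide θ σ j) (h : x.im = y.im) :
    x = y := by
  have h1 := pathSide_im_bounds hθ hx
  have h2 := pathSide_im_bounds hθ hy
  have h3 := pathVertex_im_le hθ σ (Nat.succ_le_of_lt hij) j.2.le
  simp only [Nat.succ_eq_add_one] at h3
  have h4 : x = pathVertex θ σ (i.val + 1) :=
    pathSide_unique hθ hx (right_mem_segment ℝ _ _) (by linarith)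
  have h5 : y = pathVertex θ σ j.val :=
    pathSide_unique hθ hy (left_mem_segment ℝ _ _) (by linarith)
  have h6 : i.val + 1 = j.val := by
    by_contra hne
    have := pathVertex_im_lt hθ σ (lt_of_le_of_ne (Nat.succ_le_of_lt hij) hne) j.2.le
    simp only [Nat.succ_eq_add_one] at this
    linarith
  rw [h4, h5, h6]

/-- A path meets every horizontal line at most once. -/
lemma rightside_unique (hθ : IsAdmissible θ) {σ : Perm (Fin n)} {x y : ℂ}
    (hx : x ∈ rightside θ σ) (hy : y ∈ rightside θ σ) (h : x.im = y.im) : x = y := by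
  obtain ⟨i, hi⟩ := mem_rightside.1 hx
  obtain ⟨j, hj⟩ := mem_rightside.1 hy
  rcases lt_trichotomy i j with hij | rfl | hij
  · exact pathSide_unique_of_lt hθ hij hi hj h
  · exact pathSide_unique hθ hi hj h
  · exact (pathSide_unique_of_lt hθ hij hj hi h.symm).symm

/-- All paths reach the same heights. -/
lemma rightside_exists (hθ : IsAdmissible θ) {σ : Perm (Fin n)} (τ : Perm (Fin n)) {x : ℂ}
    (hx : x ∈ rightside θ σ) : ∃ y ∈ rightside θ τ, y.im = x.im := by
  obtain ⟨i, hi⟩ := mem_rightside.1 hx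
  have h1 := pathSide_im_bounds hθ hi
  have h2 := pathVertex_im_le hθ σ (Nat.zero_le i.val) i.2.le
  have h3 := pathVertex_im_le hθ σ (Nat.succ_le_of_lt i.2) le_rfl
  rw [pathVertex_zero, ← pathVertex_zero θ τ] at h2
  simp only [Nat.succ_eq_add_one] at h3
  rw [pathVertex_last θ σ τ] at h3
  -- Climbing from the bottom vertex, the first side whose upper end reaches the given height
  -- contains a point at that height.
  have key : ∀ k : ℕ, 0 < k → k ≤ n → (pathVertex θ τ k).im ≤ x.im →
      ∃ y ∈ rightside θ τ, y.im = x.im := by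
    intro k
    induction k with
    | zero => intro h; omega
    | succ k ih =>
      intro _ hk hb
      by_cases hc : x.im ≤ (pathVertex θ τ k).im
      · have h4 := pathVertex_succ θ τ ⟨k, hk⟩
        simp only at h4
        rw [h4] at hb
        obtain ⟨y, hy, hyx⟩ := segment_exists (hθ.dir_im_neg _) hb hc
        exact ⟨y, mem_rightside.2 ⟨⟨k, hk⟩, by rwa [pathSide_eq]⟩, hyx⟩
      · have : 0 < k := by
          rcases Nat.eq_zero_or_pos k with rfl | h
          · exact absurd (by linarith) hc
          · exact h
        exact ih this (by omega) (le_of_not_ge hc)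
  exact key n i.pos le_rfl (by linarith)

end path

/-! ### The region between two paths -/

/-- The points that lie, at their height, between the paths `σ` and `τ`. -/
def betw {n : ℕ} (θ : Fin n → ℝ) (σ τ : Perm (Fin n)) : Set ℂ :=
  {z | ∃ x ∈ rightside θ σ, ∃ y ∈ rightside θ τ,
    x.im = z.im ∧ y.im = z.im ∧ x.re ≤ z.re ∧ z.re ≤ y.re}

section flip

variable {n : ℕ} {θ : Fin n → ℝ}

/-- The set of the first `k` labels changes only for `k = i + 1`. -/
lemma pathVertex_flip (θ : Fin n → ℝ) (σ : Perm (Fin n)) {i j : Fin n}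
    (hij : i.val + 1 = j.val) {k : ℕ} (hk : k ≠ j.val) :
    pathVertex θ (σ * swap i j) k = pathVertex θ σ k := by
  rw [pathVertex_eq_sum, pathVertex_eq_sum]
  refine Finset.sum_congr rfl fun a _ => ?_
  have : ((σ * swap i j).symm a).val < k ↔ (σ.symm a).val < k := by
    rw [flip_symm_apply, swap_apply_def]
    split_ifs with h1 h2
    · rw [h1]; omega
    · rw [h2]; omega
    · rfl
  simp only [this]

lemma pathSide_flip (θ : Fin n → ℝ) (σ : Perm (Fin n)) {i j : Fin n}
    (hij : i.val + 1 = j.val) {k : Fin n} (hi : k ≠ i) (hj : k ≠ j) :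
    pathSide θ (σ * swap i j) k = pathSide θ σ k := by
  rw [pathSide_eq, pathSide_eq, pathVertex_flip θ σ hij (fun h => hj (Fin.ext h)),
    Perm.mul_apply, swap_apply_of_ne_of_ne hi hj]

end flip


/-- Projects a point of a parallelogram horizontally to the broken line `A`, `A + u`, `A + u + v`.
The displacement is a nonnegative multiple of `cr u v`, so the sign of the cross product tells on
which side of the line the point lies. -/
lemma exists_horizontal {A u v : ℂ} (hu : u.im < 0) (hv : v.im < 0) {s t : ℝ}
    (hs : s ∈ Set.Icc (0 : ℝ) 1) (ht : t ∈ Set.Icc (0 : ℝ) 1) :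
    ∃ x ∈ segment ℝ A (A + u) ∪ segment ℝ (A + u) (A + u + v),
      x.im = (A + s • u + t • v).im ∧
        ∃ c : ℝ, 0 ≤ c ∧ (A + s • u + t • v).re - x.re = c * cr u v := by
  have hu' := hu.ne
  have hv' := hv.ne
  -- The left-hand number is the parameter at which the line through `A` in direction `u` reaches
  -- the height of the point; if it exceeds 1, the projection falls on the second segment.
  by_cases hc : s + t * (v.im / u.im) ≤ 1
  · have h0 : 0 ≤ v.im / u.im := div_nonneg_of_nonpos hv.le hu.le
    refine ⟨A + (s + t * (v.im / u.im)) • u, Or.inl (mem_segment_add.2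
      ⟨_, ⟨add_nonneg hs.1 (mul_nonneg ht.1 h0), hc⟩, rfl⟩), ?_, t / (-u.im),
      div_nonneg ht.1 (by linarith), ?_⟩
    · simp; field_simp; ring
    · simp [cr]; field_simp; ring
  · push Not at hc
    have e : t * (v.im / u.im) * (u.im / v.im) = t := by field_simp
    have h0 : 0 < u.im / v.im := div_pos_of_neg_of_neg hu hv
    refine ⟨A + u + (t - (1 - s) * (u.im / v.im)) • v, Or.inr (mem_segment_add.2
      ⟨_, ⟨?_, ?_⟩, rfl⟩), ?_, (1 - s) / (-v.im),
      div_nonneg (by linarith [hs.2]) (by linarith), ?_⟩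
    · nlinarith
    · nlinarith [ht.2, mul_nonneg (sub_nonneg.2 hs.2) h0.le]
    · simp; field_simp; ring
    · simp [cr]; field_simp; ring

lemma mem_segment_of_re {x y z : ℂ} (hx : x.im = z.im) (hy : y.im = z.im) (h1 : x.re ≤ z.re)
    (h2 : z.re ≤ y.re) : z ∈ segment ℝ x y := by
  rw [segment_eq_image']
  rcases h1.eq_or_lt with h | h
  · exact ⟨0, by simp, by simp; exact Complex.ext h hx⟩
  · have : 0 < y.re - x.re := by linarith
    have hr : (z.re - x.re) / (y.re - x.re) * (y.re - x.re) = z.re - x.re :=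
      div_mul_cancel₀ _ this.ne'
    have hr1 : (z.re - x.re) / (y.re - x.re) ≤ 1 := by rw [div_le_one this]; linarith
    have hr0 : 0 ≤ (z.re - x.re) / (y.re - x.re) := div_nonneg (by linarith) this.le
    generalize (z.re - x.re) / (y.re - x.re) = r at hr hr0 hr1
    refine ⟨r, ⟨hr0, hr1⟩, Complex.ext ?_ ?_⟩
    · simp; linarith
    · simp [hx, hy]

lemma Tile.convex_carrier {n : ℕ} (θ : Fin n → ℝ) (t : Tile n) : Convex ℝ (t.carrier θ) := by
  rintro _ ⟨x, hx, y, hy, rfl⟩ _ ⟨x', hx', y', hy', rfl⟩ a b ha hb hab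
  refine ⟨_, convex_Icc 0 1 hx hx' ha hb hab, _, convex_Icc 0 1 hy hy' ha hb hab, ?_⟩
  obtain rfl : b = 1 - a := by linarith
  simp only [smul_eq_mul]
  module

section flip

variable {n : ℕ} {θ : Fin n → ℝ}

lemma pathSide_succ (θ : Fin n → ℝ) (σ : Perm (Fin n)) {i j : Fin n} (hij : i.val + 1 = j.val) :
    pathSide θ σ j = segment ℝ (pathVertex θ σ i.val + dir θ (σ i))
      (pathVertex θ σ i.val + dir θ (σ i) + dir θ (σ j)) := by
  rw [pathSide_eq, ← hij, pathVertex_succ]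

lemma pathSide_flip_left (θ : Fin n → ℝ) (σ : Perm (Fin n)) {i j : Fin n}
    (hij : i.val + 1 = j.val) :
    pathSide θ (σ * swap i j) i = segment ℝ (pathVertex θ σ i.val)
      (pathVertex θ σ i.val + dir θ (σ j)) := by
  rw [pathSide_eq, pathVertex_flip θ σ hij (by omega)]
  simp

lemma pathSide_flip_right (θ : Fin n → ℝ) (σ : Perm (Fin n)) {i j : Fin n}
    (hij : i.val + 1 = j.val) :
    pathSide θ (σ * swap i j) j = segment ℝ (pathVertex θ σ i.val + dir θ (σ j))
      (pathVertex θ σ i.val + dir θ (σ j) + dir θ (σ i)) := by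
  rw [pathSide_succ θ _ hij, pathVertex_flip θ σ hij (by omega)]
  simp

lemma edges_flipTile (θ : Fin n → ℝ) (σ : Perm (Fin n)) {i j : Fin n}
    (hij : i.val + 1 = j.val) (h : σ i < σ j) :
    (flipTile θ σ i j h).edges θ = {pathSide θ σ i, pathSide θ (σ * swap i j) i,
      pathSide θ σ j, pathSide θ (σ * swap i j) j} := by
  rw [pathSide_eq, pathSide_succ θ σ hij, pathSide_flip_left θ σ hij,
    pathSide_flip_right θ σ hij, add_right_comm _ (dir θ (σ j))]
  rfl

lemma Tile.subset_carrier (θ : Fin n → ℝ) (t : Tile n) {E : Set ℂ} (hE : E ∈ t.edges θ) :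
    E ⊆ t.carrier θ := by
  have h0 : t.apex ∈ t.carrier θ := ⟨0, by simp, 0, by simp, by simp⟩
  have h1 : t.apex + dir θ t.a ∈ t.carrier θ := ⟨1, by simp, 0, by simp, by simp⟩
  have h2 : t.apex + dir θ t.b ∈ t.carrier θ := ⟨0, by simp, 1, by simp, by simp⟩
  have h3 : t.apex + dir θ t.a + dir θ t.b ∈ t.carrier θ := ⟨1, by simp, 1, by simp, by simp⟩
  have hc := t.convex_carrier θ
  rcases hE with rfl | rfl | rfl | rfl
  exacts [hc.segment_subset h0 h1, hc.segment_subset h0 h2, hc.segment_subset h1 h3,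
    hc.segment_subset h2 h3]

lemma flipTile_left (hθ : IsAdmissible θ) (σ : Perm (Fin n)) {i j : Fin n}
    (hij : i.val + 1 = j.val) (h : σ i < σ j) {z : ℂ} (hz : z ∈ (flipTile θ σ i j h).carrier θ) :
    ∃ x ∈ rightside θ σ, x.im = z.im ∧ x.re ≤ z.re := by
  obtain ⟨s, hs, t, ht, rfl⟩ := hz
  obtain ⟨x, hx, him, c, hc, hre⟩ := exists_horizontal (A := pathVertex θ σ i.val)
    (hθ.dir_im_neg (σ i)) (hθ.dir_im_neg (σ j)) hs ht
  refine ⟨x, mem_rightside.2 ?_, him, ?_⟩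
  · rcases hx with hx | hx
    · exact ⟨i, by rwa [pathSide_eq]⟩
    · exact ⟨j, by rwa [pathSide_succ θ σ hij]⟩
  · have := mul_nonneg hc (hθ.cr_pos h).le
    simp only [flipTile] at hre ⊢
    linarith

lemma flipTile_right (hθ : IsAdmissible θ) (σ : Perm (Fin n)) {i j : Fin n}
    (hij : i.val + 1 = j.val) (h : σ i < σ j) {z : ℂ} (hz : z ∈ (flipTile θ σ i j h).carrier θ) :
    ∃ y ∈ rightside θ (σ * swap i j), y.im = z.im ∧ z.re ≤ y.re := by
  obtain ⟨s, hs, t, ht, rfl⟩ := hz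
  obtain ⟨x, hx, him, c, hc, hre⟩ := exists_horizontal (A := pathVertex θ σ i.val)
    (hθ.dir_im_neg (σ j)) (hθ.dir_im_neg (σ i)) ht hs
  -- The labels are traversed in the opposite order here, which reverses the sign of the cross
  -- product.
  rw [add_right_comm] at him hre
  refine ⟨x, mem_rightside.2 ?_, him, ?_⟩
  · rcases hx with hx | hx
    · exact ⟨i, by rwa [pathSide_flip_left θ σ hij]⟩
    · exact ⟨j, by rwa [pathSide_flip_right θ σ hij]⟩
  · have := mul_nonneg hc (neg_nonneg.2 (hθ.cr_neg h).le)
    simp only [flipTile] at hre ⊢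
    linarith

lemma mem_flipTile_or (σ : Perm (Fin n)) {i j : Fin n} (hij : i.val + 1 = j.val) (h : σ i < σ j)
    {y : ℂ} (hy : y ∈ rightside θ (σ * swap i j)) :
    y ∈ rightside θ σ ∨ y ∈ (flipTile θ σ i j h).carrier θ := by
  obtain ⟨k, hk⟩ := mem_rightside.1 hy
  have he := edges_flipTile θ σ hij h
  by_cases hi : k = i
  · exact Or.inr (Tile.subset_carrier θ _ (by rw [he]; simp [hi]) hk)
  by_cases hj : k = j
  · exact Or.inr (Tile.subset_carrier θ _ (by rw [he]; simp [hj]) hk)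
  · exact Or.inl (mem_rightside.2 ⟨k, by rwa [pathSide_flip θ σ hij hi hj] at hk⟩)

lemma mem_flipTile_or' (σ : Perm (Fin n)) {i j : Fin n} (hij : i.val + 1 = j.val) (h : σ i < σ j)
    {y : ℂ} (hy : y ∈ rightside θ σ) :
    y ∈ rightside θ (σ * swap i j) ∨ y ∈ (flipTile θ σ i j h).carrier θ := by
  obtain ⟨k, hk⟩ := mem_rightside.1 hy
  have he := edges_flipTile θ σ hij h
  by_cases hi : k = i
  · exact Or.inr (Tile.subset_carrier θ _ (by rw [he]; simp [hi]) hk)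
  by_cases hj : k = j
  · exact Or.inr (Tile.subset_carrier θ _ (by rw [he]; simp [hj]) hk)
  · exact Or.inl (mem_rightside.2 ⟨k, by rwa [pathSide_flip θ σ hij hi hj]⟩)

lemma betw_self (hθ : IsAdmissible θ) (σ : Perm (Fin n)) : betw θ σ σ = rightside θ σ := by
  ext z
  constructor
  · rintro ⟨x, hx, y, hy, h1, h2, h3, h4⟩
    obtain rfl := rightside_unique hθ hx hy (by rw [h1, h2])
    rwa [← Complex.ext (le_antisymm h3 h4) h1]
  · exact fun hz => ⟨z, hz, z, hz, rfl, rfl, le_rfl, le_rfl⟩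

/-- A horizontal chord between the two paths either has an end on both paths, and then is a single
point, or has both ends in the tile, which is convex. -/
lemma betw_flip (hθ : IsAdmissible θ) (σ : Perm (Fin n)) {i j : Fin n} (hij : i.val + 1 = j.val)
    (h : σ i < σ j) :
    betw θ σ (σ * swap i j) = rightside θ σ ∪ (flipTile θ σ i j h).carrier θ := by
  have hT : (flipTile θ σ i j h).carrier θ ⊆ betw θ σ (σ * swap i j) := fun z hz => by
    obtain ⟨x, hx, h1, h2⟩ := flipTile_left hθ σ hij h hz
    obtain ⟨y, hy, h3, h4⟩ := flipTile_right hθ σ hij h hz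
    exact ⟨x, hx, y, hy, h1, h3, h2, h4⟩
  apply Set.Subset.antisymm
  · rintro z ⟨x, hx, y, hy, h1, h2, h3, h4⟩
    rcases mem_flipTile_or σ hij h hy with hy' | hy'
    · obtain rfl := rightside_unique hθ hx hy' (by rw [h1, h2])
      exact Or.inl (by rwa [← Complex.ext (le_antisymm h3 h4) h1])
    rcases mem_flipTile_or' σ hij h hx with hx' | hx'
    · obtain rfl := rightside_unique hθ hx' hy (by rw [h1, h2])
      exact Or.inl (by rwa [← Complex.ext (le_antisymm h3 h4) h1])
    · exact Or.inr ((Tile.convex_carrier θ _).segment_subset hx' hy'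
        (mem_segment_of_re h1 h2 h3 h4))
  · rintro z (hz | hz)
    · rcases mem_flipTile_or' σ hij h hz with hz' | hz'
      · exact ⟨z, hz, z, hz', rfl, rfl, le_rfl, le_rfl⟩
      · exact hT hz'
    · exact hT hz

/-- The path `σ` runs weakly to the left of the path `τ`. -/
def PathLE (θ : Fin n → ℝ) (σ τ : Perm (Fin n)) : Prop :=
  ∀ x ∈ rightside θ σ, ∀ y ∈ rightside θ τ, x.im = y.im → x.re ≤ y.re

lemma Sweep.pathLE (hθ : IsAdmissible θ) {σ τ : Perm (Fin n)} {T : Set (Tile n)}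
    (h : Sweep θ σ τ T) : PathLE θ σ τ := by
  induction h with
  | refl σ => exact fun x hx y hy he => (rightside_unique hθ hx hy he ▸ le_rfl)
  | flip σ i j hij h =>
    intro x hx y hy he
    rcases mem_flipTile_or σ hij h hy with hy | hy
    · exact rightside_unique hθ hx hy he ▸ le_rfl
    · obtain ⟨x', hx', h1, h2⟩ := flipTile_left hθ σ hij h hy
      rwa [rightside_unique hθ hx hx' (by rw [he, h1])]
  | @trans σ τ ρ T U h1 h2 ih1 ih2 =>
    intro x hx y hy he
    obtain ⟨z, hz, hzx⟩ := rightside_exists hθ τ hx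
    exact (ih1 x hx z hz hzx.symm).trans (ih2 z hz y hy (by rw [hzx, he]))

lemma betw_trans (hθ : IsAdmissible θ) {σ τ ρ : Perm (Fin n)} (h : PathLE θ σ τ)
    (h' : PathLE θ τ ρ) : betw θ σ ρ = betw θ σ τ ∪ betw θ τ ρ := by
  ext z
  constructor
  · rintro ⟨x, hx, y, hy, h1, h2, h3, h4⟩
    obtain ⟨p, hp, hpx⟩ := rightside_exists hθ τ hx
    rcases le_total z.re p.re with hc | hc
    · exact Or.inl ⟨x, hx, p, hp, h1, by rw [hpx, h1], h3, hc⟩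
    · exact Or.inr ⟨p, hp, y, hy, by rw [hpx, h1], h2, hc, h4⟩
  · rintro (⟨x, hx, y, hy, h1, h2, h3, h4⟩ | ⟨x, hx, y, hy, h1, h2, h3, h4⟩)
    · obtain ⟨p, hp, hpx⟩ := rightside_exists hθ ρ hx
      exact ⟨x, hx, p, hp, h1, by rw [hpx, h1], h3,
        h4.trans (h' y hy p hp (by rw [hpx, h1, h2]))⟩
    · obtain ⟨p, hp, hpx⟩ := rightside_exists hθ σ hx
      exact ⟨p, hp, y, hy, by rw [hpx, h1], h2, (h p hp x hx hpx).trans h3, h4⟩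

/-- The path `σ` has to be added because sides that never move need not lie in any tile. -/
lemma Sweep.betw_eq (hθ : IsAdmissible θ) {σ τ : Perm (Fin n)} {T : Set (Tile n)}
    (h : Sweep θ σ τ T) : betw θ σ τ = rightside θ σ ∪ ⋃ t ∈ T, t.carrier θ := by
  induction h with
  | refl σ => simp [betw_self hθ]
  | flip σ i j hij h => simp [betw_flip hθ σ hij h]
  | @trans σ τ ρ T U h1 h2 ih1 ih2 =>
    have hτ : rightside θ τ ⊆ betw θ σ τ := fun y hy => by
      obtain ⟨x, hx, hxy⟩ := rightside_exists hθ σ hy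
      exact ⟨x, hx, y, hy, hxy, rfl, h1.pathLE hθ x hx y hy hxy, le_rfl⟩
    rw [betw_trans hθ (h1.pathLE hθ) (h2.pathLE hθ), ih2, ← Set.union_assoc,
      Set.union_eq_self_of_subset_right hτ, ih1, Set.biUnion_union, Set.union_assoc]

lemma Sweep.carrier_subset (hθ : IsAdmissible θ) {σ τ : Perm (Fin n)} {T : Set (Tile n)}
    (h : Sweep θ σ τ T) {t : Tile n} (ht : t ∈ T) : t.carrier θ ⊆ betw θ σ τ := by
  rw [h.betw_eq hθ]
  exact (Set.subset_biUnion_of_mem (u := fun t : Tile n => t.carrier θ) ht).trans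
    Set.subset_union_right

lemma exists_horizontal_ball {s : Set ℂ} {z : ℂ} (hz : z ∈ interior s) :
    ∃ ε : ℝ, 0 < ε ∧ z + (ε : ℂ) ∈ s ∧ z - (ε : ℂ) ∈ s := by
  obtain ⟨ε, hε, hb⟩ := Metric.mem_nhds_iff.1 (mem_interior_iff_mem_nhds.1 hz)
  refine ⟨ε / 2, by positivity, hb ?_, hb ?_⟩ <;>
  · simp only [Metric.mem_ball, dist_eq_norm, add_sub_cancel_left, sub_sub_cancel_left, norm_neg,
      Complex.norm_real, Real.norm_eq_abs]
    rw [abs_of_pos (by positivity)]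
    linarith

/-- An interior point can be moved slightly to the right or to the left. Hence the points of the two
interiors lie strictly to the left and strictly to the right of the path `τ`. -/
lemma disjoint_interior_betw (hθ : IsAdmissible θ) (σ τ ρ : Perm (Fin n)) :
    Disjoint (interior (betw θ σ τ)) (interior (betw θ τ ρ)) := by
  rw [Set.disjoint_left]
  intro z hz hz'
  obtain ⟨ε, hε, ⟨x, hx, y, hy, h1, h2, h3, h4⟩, -⟩ := exists_horizontal_ball hz
  obtain ⟨δ, hδ, -, ⟨x', hx', y', hy', h1', h2', h3', h4'⟩⟩ := exists_horizontal_ball hz'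
  simp at h1 h2 h3 h4 h1' h2' h3' h4'
  have := rightside_unique hθ hy hx' (by rw [h2, h1'])
  rw [this] at h4
  linarith

lemma Sweep.disjoint (hθ : IsAdmissible θ) {σ τ : Perm (Fin n)} {T : Set (Tile n)}
    (h : Sweep θ σ τ T) : ∀ t ∈ T, ∀ u ∈ T, t ≠ u →
      Disjoint (interior (t.carrier θ)) (interior (u.carrier θ)) := by
  induction h with
  | refl σ => intro t ht; exact ht.elim
  | flip σ i j hij h => intro t ht u hu hne; exact absurd (ht.trans hu.symm) hne
  | @trans σ τ ρ T U h1 h2 ih1 ih2 =>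
    have key : ∀ t ∈ T, ∀ u ∈ U, Disjoint (interior (t.carrier θ)) (interior (u.carrier θ)) :=
      fun t ht u hu => (disjoint_interior_betw hθ σ τ ρ).mono
        (interior_mono (h1.carrier_subset hθ ht)) (interior_mono (h2.carrier_subset hθ hu))
    rintro t (ht | ht) u (hu | hu) hne
    exacts [ih1 t ht u hu hne, key t ht u hu, (key u hu t ht).symm, ih2 t ht u hu hne]

end flip


/-! ### Discreteness: sweeps are rhombic tilings -/

section discrete

variable {n : ℕ} {θ : Fin n → ℝ}

/-- Sides of two comparable paths that meet in more than one point coincide. -/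
lemma pathSide_eq_of_nontrivial (hθ : IsAdmissible θ) {σ τ : Perm (Fin n)} (hle : WeakLE σ τ)
    {i j : Fin n} (h : (pathSide θ σ i ∩ pathSide θ τ j).Nontrivial) :
    pathSide θ σ i = pathSide θ τ j := by
  obtain ⟨z, ⟨hz, hz'⟩, y, ⟨hy, hy'⟩, hne⟩ := h
  rw [pathSide_eq] at hz hz' hy hy' ⊢
  rw [pathSide_eq]
  obtain ⟨s, -, hs⟩ := mem_segment_add.1 hz
  obtain ⟨t, -, ht⟩ := mem_segment_add.1 hz'
  obtain ⟨s', -, hs'⟩ := mem_segment_add.1 hy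
  obtain ⟨t', -, ht'⟩ := mem_segment_add.1 hy'
  have hst : (s - s') • dir θ (σ i) = (t - t') • dir θ (τ j) := by
    rw [sub_smul, sub_smul]
    linear_combination (norm := module) -hs + hs' + ht - ht'
  -- Two common points make the sides parallel, so their labels agree.
  have hlab : σ i = τ j := by
    by_contra hc
    have h1 := congrArg (cr (dir θ (σ i))) hst
    rw [cr_smul, cr_smul, cr_self, mul_zero, eq_comm, mul_eq_zero] at h1
    rcases h1 with h1 | h1
    · rw [sub_eq_zero.1 h1] at ht
      exact hne (ht.trans ht'.symm)
    · exact hθ.cr_ne hc h1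
  have hPQ : pathVertex θ τ j.val - pathVertex θ σ i.val = (s - t) • dir θ (σ i) := by
    rw [← hlab] at ht
    rw [sub_smul]
    linear_combination (norm := module) hs - ht
  -- The starting points differ by a multiple of the common direction, so the cross product of that
  -- direction with their difference vanishes. Label by label, the weak order makes every term of
  -- this sum nonnegative, so all terms are zero: the same labels precede both sides.
  have hcr := congrArg (cr (dir θ (σ i))) hPQ
  rw [cr_smul, cr_self, mul_zero, pathVertex_eq_sum, pathVertex_eq_sum, ← Finset.sum_sub_distrib,
    cr_sum, Finset.sum_eq_zero_iff_of_nonneg] at hcr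
  · have hV : pathVertex θ σ i.val = pathVertex θ τ j.val := by
      rw [pathVertex_eq_sum, pathVertex_eq_sum]
      refine Finset.sum_congr rfl fun b _ => ?_
      have hb := hcr b (Finset.mem_univ b)
      by_cases hab : b = σ i
      · have hb' : b = τ j := hab.trans hlab
        rw [if_neg (by rw [hab]; simp), if_neg (by rw [hb']; simp)]
      · have hn := hθ.cr_ne (Ne.symm hab)
        split_ifs at hb ⊢
        · rfl
        · rw [zero_sub, cr_neg, neg_eq_zero] at hb
          exact absurd hb hn
        · rw [sub_zero] at hb
          exact absurd hb hn
        · rfl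
    rw [hV, hlab]
  · intro b _
    have hi : (σ.symm b).val < i.val ↔ σ.symm b < σ.symm (σ i) := by simp
    have hj : (τ.symm b).val < j.val ↔ τ.symm b < τ.symm (σ i) := by rw [hlab]; simp
    simp only [hi, hj]
    rcases lt_trichotomy b (σ i) with hb | rfl | hb
    · split_ifs with h1 h2 h2
      · simp [cr_zero]
      · exact absurd (hle _ _ hb (lt_of_le_of_ne (not_lt.1 h2)
          (fun e => hb.ne (σ.symm.injective e.symm)))) h1.not_gt
      · rw [zero_sub, Elnitsky.cr_neg]
        exact (neg_pos.2 (hθ.cr_neg hb)).le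
      · simp [cr_zero]
    · simp [cr_zero]
    · split_ifs with h1 h2 h2
      · simp [cr_zero]
      · rw [sub_zero]
        exact (hθ.cr_pos hb).le
      · exact absurd (hle _ _ hb h2) h1
      · simp [cr_zero]

/-- All edges of the tiles of a sweep are sides of paths in a chain for the weak order. -/
lemma Sweep.exists_chain {σ τ : Perm (Fin n)} {T : Set (Tile n)} (h : Sweep θ σ τ T) :
    ∃ C : Set (Perm (Fin n)), σ ∈ C ∧ τ ∈ C ∧ (∀ ρ ∈ C, WeakLE σ ρ ∧ WeakLE ρ τ) ∧
      (∀ ρ ∈ C, ∀ ρ' ∈ C, WeakLE ρ ρ' ∨ WeakLE ρ' ρ) ∧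
      ∀ t ∈ T, ∀ E ∈ t.edges θ, ∃ ρ ∈ C, ∃ k, E = pathSide θ ρ k := by
  induction h with
  | refl σ =>
    refine ⟨{σ}, rfl, rfl, ?_, ?_, fun t ht => ht.elim⟩
    · rintro ρ rfl
      exact ⟨.refl _, .refl _⟩
    · rintro ρ rfl ρ' rfl
      exact Or.inl (.refl _)
  | flip σ i j hij h =>
    have hle := weakLE_flip hij h
    refine ⟨{σ, σ * swap i j}, by simp, by simp, ?_, ?_, ?_⟩
    · rintro ρ (rfl | rfl)
      exacts [⟨.refl _, hle⟩, ⟨hle, .refl _⟩]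
    · rintro ρ (rfl | rfl) ρ' (rfl | rfl)
      exacts [Or.inl (.refl _), Or.inl hle, Or.inr hle, Or.inl (.refl _)]
    · rintro t rfl E hE
      rw [edges_flipTile θ σ hij h] at hE
      rcases hE with rfl | rfl | rfl | rfl
      exacts [⟨σ, by simp, i, rfl⟩, ⟨σ * swap i j, by simp, i, rfl⟩, ⟨σ, by simp, j, rfl⟩,
        ⟨σ * swap i j, by simp, j, rfl⟩]
  | trans h1 h2 ih1 ih2 =>
    obtain ⟨C, ha, hb, hc, hd, he⟩ := ih1
    obtain ⟨C', ha', hb', hc', hd', he'⟩ := ih2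
    refine ⟨C ∪ C', Or.inl ha, Or.inr hb', ?_, ?_, ?_⟩
    · rintro ρ (hρ | hρ)
      · exact ⟨(hc ρ hρ).1, (hc ρ hρ).2.trans h2.weakLE⟩
      · exact ⟨h1.weakLE.trans (hc' ρ hρ).1, (hc' ρ hρ).2⟩
    · rintro ρ (hρ | hρ) ρ' (hρ' | hρ')
      · exact hd _ hρ _ hρ'
      · exact Or.inl ((hc ρ hρ).2.trans (hc' ρ' hρ').1)
      · exact Or.inr ((hc ρ' hρ').2.trans (hc' ρ hρ).1)
      · exact hd' _ hρ _ hρ'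
    · rintro t (ht | ht) E hE
      · obtain ⟨ρ, hρ, h⟩ := he t ht E hE
        exact ⟨ρ, Or.inl hρ, h⟩
      · obtain ⟨ρ, hρ, h⟩ := he' t ht E hE
        exact ⟨ρ, Or.inr hρ, h⟩

/-- A side of the first path of a sweep is an edge of a swept tile, unless it is not moved. -/
lemma Sweep.side_cases {σ τ : Perm (Fin n)} {T : Set (Tile n)} (h : Sweep θ σ τ T) (k : Fin n) :
    (∃ t ∈ T, pathSide θ σ k ∈ t.edges θ) ∨ (pathSide θ τ k = pathSide θ σ k ∧ τ k = σ k ∧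
      ∀ a, τ.symm a < k ↔ σ.symm a < k) := by
  induction h with
  | refl σ => exact Or.inr ⟨rfl, rfl, fun _ => Iff.rfl⟩
  | flip σ i j hij h =>
    by_cases hi : k = i
    · exact Or.inl ⟨_, rfl, by rw [edges_flipTile θ σ hij h]; simp [hi]⟩
    by_cases hj : k = j
    · exact Or.inl ⟨_, rfl, by rw [edges_flipTile θ σ hij h]; simp [hj]⟩
    · refine Or.inr ⟨pathSide_flip θ σ hij hi hj, by simp [swap_apply_of_ne_of_ne hi hj],
        fun a => ?_⟩
      rw [flip_symm_apply, swap_apply_def]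
      simp only [Fin.lt_def, Fin.ext_iff] at *
      split_ifs <;> omega
  | trans h1 h2 ih1 ih2 =>
    rcases ih1 with ⟨t, ht, h⟩ | ⟨ha, hb, hc⟩
    · exact Or.inl ⟨t, Or.inl ht, h⟩
    rcases ih2 with ⟨t, ht, h⟩ | ⟨ha', hb', hc'⟩
    · exact Or.inl ⟨t, Or.inr ht, ha ▸ h⟩
    · exact Or.inr ⟨ha'.trans ha, hb'.trans hb, fun a => (hc' a).trans (hc a)⟩

/-- If the first `r` positions only carried labels below `r`, they would carry all of them by
cardinality. -/
lemma IsContiguous.exists_ge {w : Perm (Fin n)} (hw : IsContiguous w) {r : ℕ} (h0 : 0 < r)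
    (hr : r < n) : ∃ i : Fin n, i.val < r ∧ r ≤ (w i).val := by
  by_contra! hc
  apply hw r h0 hr
  apply Set.eq_of_subset_of_ncard_le
  · rintro _ ⟨i, hi, rfl⟩
    exact hc i hi
  · rw [Set.ncard_image_of_injective _ w.injective]
  · exact Set.toFinite _

/-- A sweep from the leftside to the rightside of a contiguous polygon is a rhombic tiling. -/
theorem Sweep.isRhombicTiling (hn : 2 < n) (hθ : IsAdmissible θ) {w : Perm (Fin n)}
    (hw : IsContiguous w) {T : Finset (Tile n)} (h : Sweep θ 1 w (T : Set (Tile n))) :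
    IsRhombicTiling θ w T := by
  obtain ⟨C, h1, hwC, -, hC, hE⟩ := h.exists_chain
  have hd : ∀ ρ ∈ C, ∀ ρ' ∈ C, ∀ k l, (pathSide θ ρ k ∩ pathSide θ ρ' l).Nontrivial →
      pathSide θ ρ k = pathSide θ ρ' l := by
    intro ρ hρ ρ' hρ' k l hkl
    rcases hC ρ hρ ρ' hρ' with h | h
    · exact pathSide_eq_of_nontrivial hθ h hkl
    · exact (pathSide_eq_of_nontrivial hθ h (by rwa [Set.inter_comm])).symm
  refine ⟨fun t ht u hu => h.disjoint hθ t ht u hu, ?_, ?_, ?_⟩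
  · have hb := h.betw_eq hθ
    have hl : rightside θ 1 ⊆ ⋃ t ∈ (T : Set (Tile n)), t.carrier θ := by
      intro z hz
      obtain ⟨k, hk⟩ := mem_rightside.1 hz
      rcases h.side_cases k with ⟨t, ht, he⟩ | ⟨-, hk1, hk2⟩
      · exact Set.mem_biUnion ht (t.subset_carrier θ he hk)
      · exfalso
        -- A left side in no tile is never moved, so `w` fixes `k` and preserves the positions
        -- before it. This contradicts contiguity at `r = k`, or at `r = 1` when `k = 0`.
        have hfix : ∀ i : Fin n, i < k → w i < k := fun i hi =>
          (hk2 (w i)).1 (by simpa using hi)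
        rcases Nat.eq_zero_or_pos k.val with h0 | h0
        · obtain ⟨i, hi, hi'⟩ := hw.exists_ge one_pos (by omega : 1 < n)
          have : i = k := Fin.ext (by omega)
          rw [this, hk1, Perm.one_apply] at hi'
          omega
        · obtain ⟨i, hi, hi'⟩ := hw.exists_ge h0 k.2
          exact absurd (hfix i hi) (not_lt.2 hi')
    rw [Set.union_eq_self_of_subset_left hl] at hb
    exact hb.symm
  · intro t ht u hu E hEt F hF hne
    obtain ⟨ρ, hρ, k, rfl⟩ := hE t ht E hEt
    obtain ⟨ρ', hρ', l, rfl⟩ := hE u hu F hF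
    exact hd _ hρ _ hρ' _ _ hne
  · intro t ht E hEt F hF hne
    obtain ⟨ρ, hρ, k, rfl⟩ := hE t ht E hEt
    rcases hF with ⟨l, rfl⟩ | ⟨l, rfl⟩
    · exact hd _ hρ _ h1 _ _ hne
    · exact hd _ hρ _ hwC _ _ hne

end discrete


/-! ### Tilings with at least three perimeter tiles -/

section perimeter

variable {n : ℕ} {θ : Fin n → ℝ}

/-- `ρ = σ` gives the left corner of the tile, `ρ = σ * swap i j` its right corner. -/
lemma isPerimeterTile_consecutive (hθ : IsAdmissible θ) {w σ ρ : Perm (Fin n)} {i j : Fin n}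
    (hij : i.val + 1 = j.val) (h : σ i < σ j) (hρ : ρ = σ ∨ ρ = σ * swap i j)
    (hi : pathSide θ ρ i ∈ polygonSides θ w) (hj : pathSide θ ρ j ∈ polygonSides θ w) :
    IsPerimeterTile θ w (flipTile θ σ i j h) := by
  have he := edges_flipTile θ σ hij h
  refine ⟨pathSide θ ρ i, ?_, pathSide θ ρ j, ?_, ?_, ?_, hi, hj⟩
  · rcases hρ with rfl | rfl <;> simp [he]
  · rcases hρ with rfl | rfl <;> simp [he]
  · rw [pathSide_eq, pathSide_succ θ ρ hij]
    intro hc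
    have := (segment_inj (hθ.dir_im_neg _) (hθ.dir_im_neg _) hc).1
    exact hθ.dir_ne_zero (ρ i) (by simpa using this)
  · rw [pathSide_eq, pathSide_succ θ ρ hij]
    exact ⟨_, right_mem_segment ℝ _ _, left_mem_segment ℝ _ _⟩

lemma isPerimeterTile_apex (hθ : IsAdmissible θ) {w σ : Perm (Fin n)} {i j : Fin n}
    (hij : i.val + 1 = j.val) (h : σ i < σ j) (hi : pathSide θ σ i ∈ polygonSides θ w)
    (hj : pathSide θ (σ * swap i j) i ∈ polygonSides θ w) :
    IsPerimeterTile θ w (flipTile θ σ i j h) := by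
  have he := edges_flipTile θ σ hij h
  refine ⟨pathSide θ σ i, by simp [he], pathSide θ (σ * swap i j) i, by simp [he], ?_, ?_, hi, hj⟩
  · rw [pathSide_eq, pathSide_flip_left θ σ hij]
    intro hc
    exact h.ne (hθ.dir_injective (segment_inj (hθ.dir_im_neg _) (hθ.dir_im_neg _) hc).2)
  · rw [pathSide_eq, pathSide_flip_left θ σ hij]
    exact ⟨_, left_mem_segment ℝ _ _, left_mem_segment ℝ _ _⟩

lemma left_mem_polygonSides (θ : Fin n → ℝ) (w : Perm (Fin n)) (i : Fin n) :
    pathSide θ 1 i ∈ polygonSides θ w := Or.inl ⟨i, rfl⟩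

lemma right_mem_polygonSides (θ : Fin n → ℝ) (w : Perm (Fin n)) (i : Fin n) :
    pathSide θ w i ∈ polygonSides θ w := Or.inr ⟨i, rfl⟩

lemma Sweep.exists_first {σ τ : Perm (Fin n)} {T : Set (Tile n)} (h : Sweep θ σ τ T)
    (hne : σ ≠ τ) : ∃ (i j : Fin n) (_ : i.val + 1 = j.val) (hlt : σ i < σ j),
      flipTile θ σ i j hlt ∈ T := by
  induction h with
  | refl σ => exact absurd rfl hne
  | flip σ i j hij h => exact ⟨i, j, hij, h, rfl⟩
  | @trans σ τ ρ T U h1 h2 ih1 ih2 =>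
    by_cases hc : σ = τ
    · subst hc
      obtain ⟨i, j, hij, hlt, hm⟩ := ih2 hne
      exact ⟨i, j, hij, hlt, Or.inr hm⟩
    · obtain ⟨i, j, hij, hlt, hm⟩ := ih1 hc
      exact ⟨i, j, hij, hlt, Or.inl hm⟩

lemma Sweep.exists_last {σ τ : Perm (Fin n)} {T : Set (Tile n)} (h : Sweep θ σ τ T)
    (hne : σ ≠ τ) : ∃ (ρ : Perm (Fin n)) (i j : Fin n) (_ : i.val + 1 = j.val)
      (hlt : ρ i < ρ j), τ = ρ * swap i j ∧ flipTile θ ρ i j hlt ∈ T := by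
  induction h with
  | refl σ => exact absurd rfl hne
  | flip σ i j hij h => exact ⟨σ, i, j, hij, h, rfl, rfl⟩
  | @trans σ τ ρ T U h1 h2 ih1 ih2 =>
    by_cases hc : τ = ρ
    · subst hc
      obtain ⟨ρ, i, j, hij, hlt, he, hm⟩ := ih1 hne
      exact ⟨ρ, i, j, hij, hlt, he, Or.inl hm⟩
    · obtain ⟨ρ, i, j, hij, hlt, he, hm⟩ := ih2 hc
      exact ⟨ρ, i, j, hij, hlt, he, Or.inr hm⟩

/-- A nontrivial sweep from the leftside contains a perimeter tile. -/
lemma Sweep.exists_perimeter_left (hθ : IsAdmissible θ) {τ : Perm (Fin n)} (w : Perm (Fin n))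
    {T : Set (Tile n)} (h : Sweep θ 1 τ T) (hne : 1 ≠ τ) : ∃ t ∈ T, IsPerimeterTile θ w t := by
  obtain ⟨i, j, hij, hlt, hm⟩ := h.exists_first hne
  exact ⟨_, hm, isPerimeterTile_consecutive hθ hij hlt (Or.inl rfl)
    (left_mem_polygonSides θ w i) (left_mem_polygonSides θ w j)⟩

/-- A nontrivial sweep to the rightside contains a perimeter tile. -/
lemma Sweep.exists_perimeter_right (hθ : IsAdmissible θ) {σ w : Perm (Fin n)}
    {T : Set (Tile n)} (h : Sweep θ σ w T) (hne : σ ≠ w) : ∃ t ∈ T, IsPerimeterTile θ w t := by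
  obtain ⟨ρ, i, j, hij, hlt, rfl, hm⟩ := h.exists_last hne
  exact ⟨_, hm, isPerimeterTile_consecutive hθ hij hlt (Or.inr rfl)
    (right_mem_polygonSides θ _ i) (right_mem_polygonSides θ _ j)⟩

/-- Along a sweep every pair of labels is inverted at most once, so tiles from different stages have
different label pairs. -/
lemma exists_tiling_of_three (hn : 2 < n) (hθ : IsAdmissible θ) {w σ τ : Perm (Fin n)}
    (hw : IsContiguous w) {T U V : Set (Tile n)} (hT : Sweep θ 1 σ T) (hU : Sweep θ σ τ U)
    (hV : Sweep θ τ w V) (ht : ∃ t ∈ T, IsPerimeterTile θ w t)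
    (hu : ∃ t ∈ U, IsPerimeterTile θ w t) (hv : ∃ t ∈ V, IsPerimeterTile θ w t) :
    ∃ T : Finset (Tile n), IsRhombicTiling θ w T ∧ perim θ w T ≠ 2 := by
  obtain ⟨t, ht, htp⟩ := ht
  obtain ⟨u, hu, hup⟩ := hu
  obtain ⟨v, hv, hvp⟩ := hv
  have h := hT.trans (hU.trans hV)
  have hfin := h.finite
  refine ⟨hfin.toFinset, Sweep.isRhombicTiling hn hθ hw (by simpa using h), ?_⟩
  have htσ := hT.inv_of_mem ht
  have huσ := hU.inv_of_mem hu
  have hvτ := hV.inv_of_mem hv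
  have hS : {x | x ∈ hfin.toFinset ∧ IsPerimeterTile θ w x}.Finite :=
    hfin.subset fun x hx => by simpa using hx.1
  refine ((Set.two_lt_ncard_iff hS).2 ⟨t, u, v, ⟨by simp [ht], htp⟩, ⟨by simp [hu], hup⟩,
    ⟨by simp [hv], hvp⟩, ?_, ?_, ?_⟩).ne'
  · rintro rfl
    exact huσ.1 htσ.2
  · rintro rfl
    exact hvτ.1 (hU.weakLE _ _ t.lt htσ.2)
  · rintro rfl
    exact hvτ.1 huσ.2

/-- The middle tile sits at the top vertex, between the first left side and the first right side.
`h0` makes the stage before it nontrivial, `h1` the stage after it. -/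
lemma IsContiguous.exists_tiling_apex (hn : 2 < n) (hθ : IsAdmissible θ) {w : Perm (Fin n)}
    (hw : IsContiguous w) {p q : Fin n} (hp : p.val = 0) (hq : q.val = 1) (h0 : w p ≠ q)
    (h1 : w q ≠ p) : ∃ T : Finset (Tile n), IsRhombicTiling θ w T ∧ perim θ w T ≠ 2 := by
  have hpq : p.val + 1 = q.val := by omega
  -- Least `coinv` means that no flip away from position 0 is possible below `w`.
  obtain ⟨σ, ⟨hσw, hσp⟩, hmin⟩ := (measure (coinv (n := n))).wf.has_min
    {σ | WeakLE σ w ∧ σ p = p} ⟨1, one_weakLE w, rfl⟩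
  have hmax : ∀ i j : Fin n, i.val + 1 = j.val → 0 < i.val → σ i < σ j →
      ¬ w.symm (σ j) < w.symm (σ i) := by
    intro i j hij hi hlt hc
    refine hmin (σ * swap i j) ⟨flip_weakLE hij hlt hσw hc, ?_⟩ (coinv_flip_lt hij hlt)
    rw [Perm.mul_apply, swap_apply_of_ne_of_ne (fun e => by omega) (fun e => by omega), hσp]
  have hwp : p < w p := by
    obtain ⟨i, hi, hi'⟩ := hw.exists_ge one_pos (by omega : 1 < n)
    obtain rfl : i = p := Fin.ext (by omega)
    exact Fin.lt_def.2 (by omega)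
  have hfirst : ∀ x, x ≠ w p → w.symm (w p) < w.symm x := by
    intro x hx
    rw [symm_apply_apply]
    refine lt_of_le_of_ne (Fin.le_def.2 (by omega)) ?_
    rintro rfl
    simp at hx
  -- If `w p` stood further down in `σ`, compare it with the label just above. An ascent there could
  -- be flipped, against the choice of `σ`; a descent would persist in `w`, where `w p` comes first.
  have hσq : σ q = w p := by
    obtain ⟨k, hk⟩ := σ.surjective (w p)
    have hkp : k.val ≠ 0 := fun e => by
      obtain rfl : k = p := Fin.ext (by omega)
      rw [hσp] at hk
      exact hwp.ne hk
    by_cases hk1 : k.val = 1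
    · rw [← hk, Fin.ext (hq.trans hk1.symm)]
    exfalso
    have hik : (⟨k.val - 1, by omega⟩ : Fin n).val + 1 = k.val := by simp only; omega
    set i : Fin n := ⟨k.val - 1, by omega⟩
    have hne : σ i ≠ σ k := fun e => by
      have := σ.injective e
      omega
    have hf := hfirst (σ i) (hk ▸ hne)
    rw [← hk] at hf
    rcases lt_or_gt_of_ne hne with hlt | hlt
    · exact hmax i k hik (by omega) hlt hf
    · refine (hσw _ _ hlt ?_).not_gt hf
      rw [symm_apply_apply, symm_apply_apply]
      exact Fin.lt_def.2 (by omega)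
  have hlt : σ p < σ q := by rwa [hσp, hσq]
  obtain ⟨T, hT⟩ := exists_sweep θ (one_weakLE σ)
  obtain ⟨V, hV⟩ := exists_sweep θ (flip_weakLE hpq hlt hσw
    (by rw [hσq, hσp]; exact hfirst p hwp.ne))
  refine exists_tiling_of_three hn hθ hw hT (Sweep.flip σ p q hpq hlt) hV
    (hT.exists_perimeter_left hθ w ?_) ⟨_, rfl, isPerimeterTile_apex hθ hpq hlt ?_ ?_⟩
    (hV.exists_perimeter_right hθ ?_)
  · rintro rfl
    exact h0 hσq.symm
  · have : pathSide θ σ p = pathSide θ 1 p := by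
      rw [pathSide_eq, pathSide_eq, hσp, hp, pathVertex_zero, pathVertex_zero, Perm.one_apply]
    rw [this]
    exact left_mem_polygonSides θ w p
  · have : pathSide θ (σ * swap p q) p = pathSide θ w p := by
      rw [pathSide_eq, pathSide_eq, Perm.mul_apply, swap_apply_left, hσq, hp, pathVertex_zero,
        pathVertex_zero]
    rw [this]
    exact right_mem_polygonSides θ w p
  · intro hc
    apply h1
    rw [← hc, Perm.mul_apply, swap_apply_right, hσp]

/-- Such a product preserves the first two positions. -/
lemma IsContiguous.ne_swap_mul_swap (hn : 2 < n) {w : Perm (Fin n)} (hw : IsContiguous w)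
    {p q k l : Fin n} (hp : p.val = 0) (hq : q.val = 1) (hk : 2 ≤ k.val) (hl : 2 ≤ l.val) :
    w ≠ swap p q * swap k l := by
  rintro rfl
  obtain ⟨i, hi, hi'⟩ := hw.exists_ge two_pos hn
  rw [Perm.mul_apply, swap_apply_of_ne_of_ne (a := k) (fun e => by omega) (fun e => by omega),
    swap_apply_def] at hi'
  split_ifs at hi' <;> omega

/-- The two flips act on disjoint positions, so after the first one the sides at `k` and `l` are
still left sides of the polygon. -/
lemma IsContiguous.exists_tiling_left (hn : 2 < n) (hθ : IsAdmissible θ) {w : Perm (Fin n)}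
    (hw : IsContiguous w) {p q k l : Fin n} (hp : p.val = 0) (hq : q.val = 1) (hk : 2 ≤ k.val)
    (hkl : k.val + 1 = l.val) (h0 : w.symm q < w.symm p) (h1 : w.symm l < w.symm k) :
    ∃ T : Finset (Tile n), IsRhombicTiling θ w T ∧ perim θ w T ≠ 2 := by
  have hpq : p.val + 1 = q.val := by omega
  have hlt : (1 : Perm (Fin n)) p < (1 : Perm (Fin n)) q := Fin.lt_def.2 (by simp; omega)
  have hσk : (1 * swap p q : Perm (Fin n)) k = k := by
    rw [one_mul, swap_apply_of_ne_of_ne (fun e => by omega) (fun e => by omega)]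
  have hσl : (1 * swap p q : Perm (Fin n)) l = l := by
    rw [one_mul, swap_apply_of_ne_of_ne (fun e => by omega) (fun e => by omega)]
  have hlt' : (1 * swap p q : Perm (Fin n)) k < (1 * swap p q : Perm (Fin n)) l := by
    rw [hσk, hσl]
    exact Fin.lt_def.2 (by omega)
  have hσw : WeakLE (1 * swap p q) w := flip_weakLE hpq hlt (one_weakLE w) h0
  obtain ⟨V, hV⟩ := exists_sweep θ (flip_weakLE hkl hlt' hσw (by rwa [hσk, hσl]))
  refine exists_tiling_of_three hn hθ hw (Sweep.flip 1 p q hpq hlt) (Sweep.flip _ k l hkl hlt') hV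
    ((Sweep.flip 1 p q hpq hlt).exists_perimeter_left hθ w ?_)
    ⟨_, rfl, isPerimeterTile_consecutive hθ hkl hlt' (Or.inl rfl) ?_ ?_⟩
    (hV.exists_perimeter_right hθ ?_)
  · intro hc
    have := congrArg (fun ρ : Perm (Fin n) => ρ p) hc
    simp at this
    omega
  · rw [pathSide_flip θ 1 hpq (fun e => by omega) (fun e => by omega)]
    exact left_mem_polygonSides θ w k
  · rw [pathSide_flip θ 1 hpq (fun e => by omega) (fun e => by omega)]
    exact left_mem_polygonSides θ w l
  · rw [one_mul]
    exact (hw.ne_swap_mul_swap hn hp hq hk (by omega)).symm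

/-- Mirror image of `IsContiguous.exists_tiling_left`: two descents of `w` at disjoint positions are
undone, and the corresponding flips end the sweep. -/
lemma IsContiguous.exists_tiling_right (hn : 2 < n) (hθ : IsAdmissible θ) {w : Perm (Fin n)}
    (hw : IsContiguous w) {p q k l : Fin n} (hp : p.val = 0) (hq : q.val = 1) (hk : 2 ≤ k.val)
    (hkl : k.val + 1 = l.val) (h0 : w q < w p) (h1 : w l < w k) :
    ∃ T : Finset (Tile n), IsRhombicTiling θ w T ∧ perim θ w T ≠ 2 := by
  have hpq : p.val + 1 = q.val := by omega
  obtain ⟨τ, rfl⟩ : ∃ τ, w = τ * swap p q := ⟨w * swap p q, by simp [mul_assoc]⟩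
  have hk' : (τ * swap p q) k = τ k := by
    rw [Perm.mul_apply, swap_apply_of_ne_of_ne (fun e => by omega) (fun e => by omega)]
  have hl' : (τ * swap p q) l = τ l := by
    rw [Perm.mul_apply, swap_apply_of_ne_of_ne (fun e => by omega) (fun e => by omega)]
  rw [hk', hl'] at h1
  simp only [Perm.mul_apply, swap_apply_left, swap_apply_right] at h0
  obtain ⟨σ, rfl⟩ : ∃ σ, τ = σ * swap k l := ⟨τ * swap k l, by simp [mul_assoc]⟩
  simp only [Perm.mul_apply, swap_apply_left, swap_apply_right] at h1
  obtain ⟨T, hT⟩ := exists_sweep θ (one_weakLE σ)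
  refine exists_tiling_of_three hn hθ hw hT (Sweep.flip σ k l hkl h1) (Sweep.flip _ p q hpq h0)
    (hT.exists_perimeter_left hθ _ ?_)
    ⟨_, rfl, isPerimeterTile_consecutive hθ hkl h1 (Or.inr rfl) ?_ ?_⟩
    ((Sweep.flip _ p q hpq h0).exists_perimeter_right hθ ?_)
  · rintro rfl
    refine hw.ne_swap_mul_swap hn hp hq hk (by omega : 2 ≤ l.val) ?_
    ext i
    simp only [one_mul, Perm.mul_apply, swap_apply_def]
    simp only [Fin.ext_iff]
    split_ifs <;> omega
  · rw [← pathSide_flip θ _ hpq (fun e => by omega) (fun e => by omega)]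
    exact right_mem_polygonSides θ _ k
  · rw [← pathSide_flip θ _ hpq (fun e => by omega) (fun e => by omega)]
    exact right_mem_polygonSides θ _ l
  · intro hc
    have := congrArg (fun ρ : Perm (Fin n) => ρ p) hc
    simp only [Perm.mul_apply _ (swap p q), swap_apply_left] at this
    have := (σ * swap k l).injective this
    omega

lemma IsContiguous.symm {w : Perm (Fin n)} (hw : IsContiguous w) :
    IsContiguous (w.symm : Perm (Fin n)) := by
  intro r h0 hr hc
  apply hw r h0 hr
  conv_lhs => rw [← hc]
  rw [← Set.image_comp]
  simp

/-- The values increase from position 1 on, so only `g 0` is free. Contiguity forces it to be the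
largest label, and the others then fill the remaining values in order. -/
lemma IsContiguous.isLastFirst {g : Perm (Fin n)} (hg : IsContiguous g) {p q : Fin n}
    (hp : p.val = 0) (hq : q.val = 1) (hgq : g q = p)
    (h : ∀ k l : Fin n, 2 ≤ k.val → k.val + 1 = l.val → g k < g l) : IsLastFirst g := by
  have hstep : ∀ k l : Fin n, 1 ≤ k.val → k.val + 1 = l.val → (g k).val + 1 ≤ (g l).val := by
    intro k l hk hkl
    rcases hk.eq_or_lt with hk | hk
    · obtain rfl : k = q := Fin.ext (by omega)
      have : g l ≠ p := fun e => by
        have := g.injective (e.trans hgq.symm)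
        omega
      rw [hgq]
      omega
    · exact h k l hk hkl
  have hmono : ∀ d : ℕ, ∀ x y : Fin n, 1 ≤ x.val → x.val + d = y.val →
      (g x).val + d ≤ (g y).val := by
    intro d
    induction d with
    | zero =>
      intro x y _ hxy
      obtain rfl : x = y := Fin.ext hxy
      simp
    | succ d ih =>
      intro x y hx hxy
      have h1 := ih x ⟨x.val + d, by omega⟩ hx rfl
      have h2 := hstep ⟨x.val + d, by omega⟩ y (by simp only; omega) (by simp only; omega)
      omega
  have hlow : ∀ y : Fin n, 1 ≤ y.val → y.val ≤ (g y).val + 1 := by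
    intro y hy
    have := hmono (y.val - 1) q y (by omega) (by omega)
    omega
  have hlast : (g p).val = n - 1 := by
    by_contra hc
    -- By `hlow`, a label from a position at least 1 is at most one less than its position. With `r
    -- = g p + 1` this leaves only `i = g p`, whose position is 0.
    obtain ⟨i, hi, hi'⟩ := hg.symm.exists_ge (r := (g p).val + 1) (by omega) (by omega)
    have h1 := hlow (g.symm i) (by omega)
    rw [apply_symm_apply] at h1
    obtain rfl : i = g p := Fin.ext (by omega)
    rw [symm_apply_apply] at hi'
    omega
  intro x
  split_ifs with hx
  · obtain rfl : x = p := Fin.ext (by omega)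
    exact hlast
  · have h1 := hlow x (by omega)
    have h2 := hmono (n - 1 - x.val) x ⟨n - 1, by omega⟩ (by omega) (by simp only; omega)
    have h3 : (g ⟨n - 1, by omega⟩).val ≠ n - 1 := fun e => by
      have := g.injective (Fin.ext (e.trans hlast.symm))
      rw [Fin.ext_iff] at this
      simp only at this
      omega
    omega

lemma IsLastFirst.symm {w : Perm (Fin n)} (h : IsLastFirst (w.symm : Perm (Fin n))) :
    IsFirstLast w := by
  intro i
  have := h (w i)
  rw [symm_apply_apply] at this
  split_ifs at this ⊢ <;> omega

/-- If `w` is none of the two exceptional permutations, then some tiling has at least three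
perimeter tiles. -/
theorem IsContiguous.exists_tiling (hn : 2 < n) (hθ : IsAdmissible θ) {w : Perm (Fin n)}
    (hw : IsContiguous w) (h1 : ¬ IsLastFirst w) (h2 : ¬ IsFirstLast w) :
    ∃ T : Finset (Tile n), IsRhombicTiling θ w T ∧ perim θ w T ≠ 2 := by
  set p : Fin n := ⟨0, by omega⟩
  set q : Fin n := ⟨1, by omega⟩
  by_cases hp : w p = q
  -- Labels of `w` are positions of its inverse: either the inverse increases from 2 on and
  -- `isLastFirst` applies to it, or some `k, k + 1` are inverted in `w`.
  · have hq : w.symm q = p := by rw [← hp, symm_apply_apply]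
    by_contra hc
    refine h2 (IsLastFirst.symm (hw.symm.isLastFirst (p := p) (q := q) rfl rfl hq ?_))
    intro k l hk hkl
    by_contra hlt
    have hne : w.symm k ≠ w.symm l := fun e => by
      have := w.symm.injective e
      omega
    refine hc (hw.exists_tiling_left hn hθ (p := p) (q := q) rfl rfl hk hkl ?_
      (lt_of_le_of_ne (not_lt.1 hlt) hne.symm))
    rw [hq]
    refine lt_of_le_of_ne (Fin.le_def.2 (Nat.zero_le _)) fun e => ?_
    have := w.symm.injective (hq.trans e)
    simp [p, q] at this
  by_cases hq : w q = p
  · by_contra hc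
    refine h1 (hw.isLastFirst (p := p) (q := q) rfl rfl hq ?_)
    intro k l hk hkl
    by_contra hlt
    have hne : w k ≠ w l := fun e => by
      have := w.injective e
      omega
    refine hc (hw.exists_tiling_right hn hθ (p := p) (q := q) rfl rfl hk hkl ?_
      (lt_of_le_of_ne (not_lt.1 hlt) hne.symm))
    rw [hq]
    refine lt_of_le_of_ne (Fin.le_def.2 (Nat.zero_le _)) fun e => ?_
    have := w.injective (hq.trans e)
    simp [p, q] at this
  exact hw.exists_tiling_apex hn hθ (p := p) (q := q) rfl rfl hp hq

end perimeter


/-! ### Geometry of a single rhombus -/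

section tile

variable {n : ℕ} {θ : Fin n → ℝ}

/-- The edge labels of `t` are `x` and `y`, in some order. -/
def Tile.HasLabels (t : Tile n) (x y : Fin n) : Prop :=
  (t.a = x ∧ t.b = y) ∨ (t.a = y ∧ t.b = x)

lemma Tile.eq_of_hasLabels {t u : Tile n} {x y : Fin n} (ht : t.HasLabels x y)
    (hu : u.HasLabels x y) (h : t.apex = u.apex) : t = u := by
  obtain ⟨P, a, b, hab⟩ := t
  obtain ⟨Q, c, d, hcd⟩ := u
  simp only [Tile.HasLabels] at ht hu h
  subst h
  rcases ht with ⟨rfl, rfl⟩ | ⟨rfl, rfl⟩ <;> rcases hu with ⟨rfl, rfl⟩ | ⟨rfl, rfl⟩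
  · rfl
  · exact absurd hab hcd.not_gt
  · exact absurd hab hcd.not_gt
  · rfl

lemma Tile.HasLabels.mem_carrier {t : Tile n} {x y : Fin n} (h : t.HasLabels x y) {z : ℂ} :
    z ∈ t.carrier θ ↔ ∃ r ∈ Set.Icc (0 : ℝ) 1, ∃ s ∈ Set.Icc (0 : ℝ) 1,
      z = t.apex + r • dir θ x + s • dir θ y := by
  rcases h with ⟨rfl, rfl⟩ | ⟨rfl, rfl⟩
  · rfl
  · constructor
    · rintro ⟨r, hr, s, hs, rfl⟩
      exact ⟨s, hs, r, hr, add_right_comm _ _ _⟩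
    · rintro ⟨r, hr, s, hs, rfl⟩
      exact ⟨s, hs, r, hr, add_right_comm _ _ _⟩

lemma Tile.HasLabels.mem_edges {t : Tile n} {x y : Fin n} (h : t.HasLabels x y) {E : Set ℂ} :
    E ∈ t.edges θ ↔ E = segment ℝ t.apex (t.apex + dir θ x) ∨
      E = segment ℝ t.apex (t.apex + dir θ y) ∨
      E = segment ℝ (t.apex + dir θ x) (t.apex + dir θ x + dir θ y) ∨
      E = segment ℝ (t.apex + dir θ y) (t.apex + dir θ y + dir θ x) := by
  rcases h with ⟨rfl, rfl⟩ | ⟨rfl, rfl⟩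
  · rw [add_right_comm t.apex (dir θ t.b)]
    rfl
  · rw [add_right_comm t.apex (dir θ t.b)]
    simp only [Tile.edges, Set.mem_insert_iff, Set.mem_singleton_iff]
    tauto

lemma Tile.hasLabels (t : Tile n) : t.HasLabels t.a t.b := Or.inl ⟨rfl, rfl⟩

lemma Tile.HasLabels.ne {t : Tile n} {x y : Fin n} (h : t.HasLabels x y) : x ≠ y := by
  rcases h with ⟨rfl, rfl⟩ | ⟨rfl, rfl⟩
  exacts [t.lt.ne, t.lt.ne']

lemma Tile.isClosed_carrier (θ : Fin n → ℝ) (t : Tile n) : IsClosed (t.carrier θ) := by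
  have : t.carrier θ = (fun p : ℝ × ℝ => t.apex + p.1 • dir θ t.a + p.2 • dir θ t.b) ''
      (Set.Icc 0 1 ×ˢ Set.Icc 0 1) := by
    ext z
    constructor
    · rintro ⟨r, hr, s, hs, rfl⟩
      exact ⟨(r, s), ⟨hr, hs⟩, rfl⟩
    · rintro ⟨⟨r, s⟩, ⟨hr, hs⟩, rfl⟩
      exact ⟨r, hr, s, hs, rfl⟩
  rw [this]
  exact ((isCompact_Icc.prod isCompact_Icc).image (by fun_prop)).isClosed

lemma Tile.finite_edges (θ : Fin n → ℝ) (t : Tile n) : (t.edges θ).Finite := by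
  unfold Tile.edges
  exact Set.toFinite _

lemma Tile.HasLabels.mem_interior (hθ : IsAdmissible θ) {t : Tile n} {x y : Fin n}
    (h : t.HasLabels x y) {r s : ℝ} (hr : r ∈ Set.Ioo (0 : ℝ) 1) (hs : s ∈ Set.Ioo (0 : ℝ) 1) :
    t.apex + r • dir θ x + s • dir θ y ∈ interior (t.carrier θ) := by
  have hc := hθ.cr_ne h.ne
  set u := dir θ x
  set v := dir θ y
  -- By Cramer's rule `f` and `g` are the coordinates along the two edges; both are continuous.
  let f : ℂ → ℝ := fun z => cr (z - t.apex) v / cr u v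
  let g : ℂ → ℝ := fun z => cr u (z - t.apex) / cr u v
  have hf : Continuous f := by
    simp only [f, cr, Complex.sub_re, Complex.sub_im]
    fun_prop
  have hg : Continuous g := by
    simp only [g, cr, Complex.sub_re, Complex.sub_im]
    fun_prop
  refine _root_.mem_interior.2 ⟨f ⁻¹' Set.Ioo 0 1 ∩ g ⁻¹' Set.Ioo 0 1, ?_,
    (isOpen_Ioo.preimage hf).inter (isOpen_Ioo.preimage hg), ?_, ?_⟩
  · rintro z ⟨hz, hz'⟩
    refine h.mem_carrier.2 ⟨f z, Set.Ioo_subset_Icc_self hz, g z, Set.Ioo_subset_Icc_self hz', ?_⟩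
    apply Complex.ext
    · have : (z.re - t.apex.re) * cr u v = cr (z - t.apex) v * u.re + cr u (z - t.apex) * v.re := by
        simp [cr]; ring
      have h2 : z.re - t.apex.re = f z * u.re + g z * v.re := by
        simp only [f, g]
        field_simp
        linarith
      simp only [Complex.add_re, Complex.smul_re, smul_eq_mul]
      linarith
    · have : (z.im - t.apex.im) * cr u v = cr (z - t.apex) v * u.im + cr u (z - t.apex) * v.im := by
        simp [cr]; ring
      have h2 : z.im - t.apex.im = f z * u.im + g z * v.im := by
        simp only [f, g]
        field_simp
        linarith
      simp only [Complex.add_im, Complex.smul_im, smul_eq_mul]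
      linarith
  · have : f (t.apex + r • u + s • v) = r := by
      simp only [f]
      rw [div_eq_iff hc]
      simp [cr]; ring
    rwa [Set.mem_preimage, this]
  · have : g (t.apex + r • u + s • v) = s := by
      simp only [g]
      rw [div_eq_iff hc]
      simp [cr]; ring
    rwa [Set.mem_preimage, this]

lemma Tile.interior_nonempty (hθ : IsAdmissible θ) (t : Tile n) :
    (interior (t.carrier θ)).Nonempty :=
  ⟨_, t.hasLabels.mem_interior hθ (r := 1 / 2) (s := 1 / 2) (by norm_num) (by norm_num)⟩

/-- A boundary point of a tile lies on one of its edges. -/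
lemma Tile.exists_edge (hθ : IsAdmissible θ) (t : Tile n) {z : ℂ} (hz : z ∈ t.carrier θ)
    (hi : z ∉ interior (t.carrier θ)) : ∃ E ∈ t.edges θ, z ∈ E := by
  obtain ⟨r, hr, s, hs, rfl⟩ := hz
  have hm := fun E => t.hasLabels.mem_edges (θ := θ) (E := E)
  rcases hr.1.eq_or_lt with rfl | hr0
  · exact ⟨_, (hm _).2 (Or.inr (Or.inl rfl)), mem_segment_add.2 ⟨s, hs, by simp⟩⟩
  rcases hr.2.eq_or_lt with rfl | hr1
  · exact ⟨_, (hm _).2 (Or.inr (Or.inr (Or.inl rfl))), mem_segment_add.2 ⟨s, hs, by simp⟩⟩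
  rcases hs.1.eq_or_lt with rfl | hs0
  · exact ⟨_, (hm _).2 (Or.inl rfl), mem_segment_add.2 ⟨r, hr, by simp⟩⟩
  rcases hs.2.eq_or_lt with rfl | hs1
  · exact ⟨_, (hm _).2 (Or.inr (Or.inr (Or.inr rfl))),
      mem_segment_add.2 ⟨r, hr, by rw [one_smul, add_right_comm]⟩⟩
  exact absurd (t.hasLabels.mem_interior hθ ⟨hr0, hr1⟩ ⟨hs0, hs1⟩) hi

/-- Tiles with disjoint interiors: no point of one lies in the interior of the other. -/
lemma Tile.notMem_interior (hθ : IsAdmissible θ) {t u : Tile n}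
    (h : Disjoint (interior (t.carrier θ)) (interior (u.carrier θ))) {z : ℂ}
    (hz : z ∈ t.carrier θ) : z ∉ interior (u.carrier θ) := by
  intro hu
  have hcl : closure (interior (t.carrier θ)) = closure (t.carrier θ) :=
    (t.convex_carrier θ).closure_interior_eq_closure_of_nonempty_interior
      (t.interior_nonempty hθ)
  obtain ⟨y, hy, hy'⟩ := mem_closure_iff.1 (hcl ▸ subset_closure hz) _ isOpen_interior hu
  exact Set.disjoint_left.1 h hy' hy

end tile

/-! ### Strips and the uniqueness of their tiling -/

/-- The polygon is a strip of parallel translates of a side labeled `ℓ`: it is tiled by the tiles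
`t 0, …, t (m - 1)` with labels `ℓ`, `q k`, stacked along the path with vertices `V k`. -/
structure Strip {n : ℕ} (θ : Fin n → ℝ) (w : Perm (Fin n)) (ℓ : Fin n) (ε : ℝ) (m : ℕ) (V : ℕ → ℂ)
    (q : ℕ → Fin n) (t : ℕ → Tile n) : Prop where
  pos : ∀ b, b ≠ ℓ → 0 < ε * cr (dir θ ℓ) (dir θ b)
  ne : ∀ k < m, q k ≠ ℓ
  succ : ∀ k < m, V (k + 1) = V k + dir θ (q k)
  apex : ∀ k < m, (t k).apex = V k
  labels : ∀ k < m, (t k).HasLabels ℓ (q k)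
  mem_region : ∀ z, z ∈ region θ w ↔ ∃ k < m, z ∈ (t k).carrier θ
  first : segment ℝ (V 0) (V 0 + dir θ ℓ) ∈ polygonSides θ w

namespace Strip

variable {n : ℕ} {θ : Fin n → ℝ} {w : Perm (Fin n)} {ℓ : Fin n} {ε : ℝ} {m : ℕ} {V : ℕ → ℂ}
  {q : ℕ → Fin n} {t : ℕ → Tile n}

/-- The coordinate transverse to the sides labeled `ℓ`. -/
def height (θ : Fin n → ℝ) (ℓ : Fin n) (ε : ℝ) (z : ℂ) : ℝ := ε * cr (dir θ ℓ) z

lemma height_add (y z : ℂ) : height θ ℓ ε (y + z) = height θ ℓ ε y + height θ ℓ ε z := by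
  simp only [height, cr_add]; ring

lemma height_smul (r : ℝ) (z : ℂ) : height θ ℓ ε (r • z) = r * height θ ℓ ε z := by
  simp only [height, cr_smul]; ring

lemma height_self : height θ ℓ ε (dir θ ℓ) = 0 := by simp [height, cr_self]

lemma height_lt (h : Strip θ w ℓ ε m V q t) {i j : ℕ} (hij : i < j) (hj : j ≤ m) :
    height θ ℓ ε (V i) < height θ ℓ ε (V j) := by
  induction j with
  | zero => omega
  | succ j ih =>
    rw [h.succ j hj, height_add]
    have : 0 < height θ ℓ ε (dir θ (q j)) := h.pos _ (h.ne j hj)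
    rcases (Nat.lt_succ_iff.1 hij).lt_or_eq with h1 | rfl
    · linarith [ih h1 (by omega)]
    · linarith

lemma height_le (h : Strip θ w ℓ ε m V q t) {i j : ℕ} (hij : i ≤ j) (hj : j ≤ m) :
    height θ ℓ ε (V i) ≤ height θ ℓ ε (V j) := by
  rcases hij.lt_or_eq with h1 | rfl
  exacts [(h.height_lt h1 hj).le, le_rfl]

lemma height_mem (h : Strip θ w ℓ ε m V q t) {k : ℕ} (hk : k < m) {z : ℂ}
    (hz : z ∈ (t k).carrier θ) :
    height θ ℓ ε (V k) ≤ height θ ℓ ε z ∧ height θ ℓ ε z ≤ height θ ℓ ε (V (k + 1)) := by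
  obtain ⟨r, hr, s, hs, rfl⟩ := (h.labels k hk).mem_carrier.1 hz
  have hp : 0 < height θ ℓ ε (dir θ (q k)) := h.pos _ (h.ne k hk)
  rw [h.succ k hk, h.apex k hk]
  simp only [height_add, height_smul, height_self]
  constructor <;> nlinarith [hs.1, hs.2]

/-- The tiles occupy consecutive slabs of heights, so only one of them reaches the open slab number
`k`. -/
lemma mem_of_height (h : Strip θ w ℓ ε m V q t) {k : ℕ} (hk : k < m) {z : ℂ}
    (hz : z ∈ region θ w) (h1 : height θ ℓ ε (V k) < height θ ℓ ε z)
    (h2 : height θ ℓ ε z < height θ ℓ ε (V (k + 1))) : z ∈ (t k).carrier θ := by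
  obtain ⟨j, hj, hzj⟩ := (h.mem_region z).1 hz
  have h3 := h.height_mem hj hzj
  rcases lt_trichotomy j k with hjk | rfl | hjk
  · linarith [h.height_le (Nat.succ_le_of_lt hjk) hk.le]
  · exact hzj
  · linarith [h.height_le (Nat.succ_le_of_lt hjk) hj.le]

lemma edge_mem (h : Strip θ w ℓ ε m V q t) {k : ℕ} (hk : k < m) :
    segment ℝ (V (k + 1)) (V (k + 1) + dir θ ℓ) ∈ (t k).edges θ := by
  rw [(h.labels k hk).mem_edges, h.apex k hk, h.succ k hk]
  exact Or.inr (Or.inr (Or.inr rfl))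

/-- A point inside the side `V k, V k + dir ℓ` of a strip tile lies on an edge of a tile that
continues the strip beyond that side. -/
lemma exists_tile (hθ : IsAdmissible θ) (h : Strip θ w ℓ ε m V q t) {T : Finset (Tile n)}
    (hT : IsRhombicTiling θ w T) {k : ℕ} (hk : k < m) (hprev : ∀ j, j + 1 = k → t j ∈ T)
    {x : ℝ} (hx : x ∈ Set.Ioo (0 : ℝ) 1) :
    ∃ u ∈ T, (∃ z ∈ u.carrier θ, height θ ℓ ε (V k) < height θ ℓ ε z) ∧
      ∃ F ∈ u.edges θ, V k + x • dir θ ℓ ∈ F := by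
  have hp : 0 < height θ ℓ ε (dir θ (q k)) := h.pos _ (h.ne k hk)
  have hTr : ∀ u ∈ T, u.carrier θ ⊆ region θ w := fun u hu => by
    rw [← hT.cover]
    exact Set.subset_biUnion_of_mem (u := fun u : Tile n => u.carrier θ) hu
  set K : Set ℂ := ⋃ u ∈ {u | u ∈ T ∧ ∃ z ∈ u.carrier θ, height θ ℓ ε (V k) < height θ ℓ ε z},
    u.carrier θ
  have hK : IsClosed K := Set.Finite.isClosed_biUnion
    (T.finite_toSet.subset fun u hu => hu.1) fun u _ => u.isClosed_carrier θ
  -- The point is a limit of region points just beyond the side; these lie in tiles reaching beyond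
  -- it, whose finite union is closed.
  have hmem : V k + x • dir θ ℓ ∈ K := by
    have hlim : Filter.Tendsto (fun y : ℝ => V k + x • dir θ ℓ + y • dir θ (q k))
        (nhdsWithin 0 (Set.Ioi 0)) (nhds (V k + x • dir θ ℓ)) := by
      have : Continuous fun y : ℝ => V k + x • dir θ ℓ + y • dir θ (q k) := by fun_prop
      simpa using (this.tendsto 0).mono_left nhdsWithin_le_nhds
    refine hK.mem_of_tendsto hlim ?_
    filter_upwards [Ioo_mem_nhdsGT (zero_lt_one' ℝ)] with y hy
    have hr : V k + x • dir θ ℓ + y • dir θ (q k) ∈ region θ w :=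
      (h.mem_region _).2 ⟨k, hk, (h.labels k hk).mem_carrier.2
        ⟨x, Set.Ioo_subset_Icc_self hx, y, Set.Ioo_subset_Icc_self hy, by rw [h.apex k hk]⟩⟩
    rw [← hT.cover] at hr
    obtain ⟨u, hu, hyu⟩ := Set.mem_iUnion₂.1 hr
    refine Set.mem_biUnion (x := u) ⟨hu, _, hyu, ?_⟩ hyu
    simp only [height_add, height_smul, height_self]
    nlinarith [hy.1]
  obtain ⟨u, ⟨hu, hz⟩, hxu⟩ := Set.mem_iUnion₂.1 hmem
  refine ⟨u, hu, hz, u.exists_edge hθ hxu fun hi => ?_⟩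
  -- The point is not interior to the tile: for `k = 0` a step backwards leaves the region,
  -- otherwise the point belongs to the preceding strip tile, which is in `T`.
  rcases k with _ | j
  · have hlim : Filter.Tendsto (fun y : ℝ => V 0 + x • dir θ ℓ - y • dir θ (q 0))
        (nhdsWithin 0 (Set.Ioi 0)) (nhds (V 0 + x • dir θ ℓ)) := by
      have : Continuous fun y : ℝ => V 0 + x • dir θ ℓ - y • dir θ (q 0) := by fun_prop
      simpa using (this.tendsto 0).mono_left nhdsWithin_le_nhds
    obtain ⟨y, hy, hy0⟩ := ((hlim.eventually (isOpen_interior.mem_nhds hi)).and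
      self_mem_nhdsWithin).exists
    obtain ⟨i, hi, hyi⟩ := (h.mem_region _).1 (hTr u hu (interior_subset hy))
    have h1 := (h.height_mem hi hyi).1
    have h2 := h.height_le (Nat.zero_le i) hi.le
    rw [sub_eq_add_neg, ← neg_smul] at h1
    simp only [height_add, height_smul, height_self] at h1
    have := mul_pos (Set.mem_Ioi.1 hy0) hp
    linarith
  · have hj : j < m := by omega
    refine Tile.notMem_interior hθ (hT.disjoint _ (hprev j rfl) _ hu ?_) ?_ hi
    · rintro rfl
      obtain ⟨z, hz, hlt⟩ := hz
      exact ((h.height_mem hj hz).2).not_gt hlt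
    · refine (t j).subset_carrier θ (h.edge_mem hj) ?_
      exact mem_segment_add.2 ⟨x, Set.Ioo_subset_Icc_self hx, rfl⟩

/-- A tile with an edge `V k, V k + dir ℓ` that continues the strip beyond that edge is `t k`. -/
lemma eq_tile (hθ : IsAdmissible θ) (h : Strip θ w ℓ ε m V q t) {k : ℕ} (hk : k < m) {u : Tile n}
    (hu : u.carrier θ ⊆ region θ w)
    (hz : ∃ z ∈ u.carrier θ, height θ ℓ ε (V k) < height θ ℓ ε z)
    (hE : segment ℝ (V k) (V k + dir θ ℓ) ∈ u.edges θ) : u = t k := by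
  have hlab : ∃ b, u.HasLabels ℓ b ∧ (V k = u.apex ∨ V k = u.apex + dir θ b) := by
    have hinj : ∀ {P : ℂ} {x : Fin n}, segment ℝ (V k) (V k + dir θ ℓ) =
        segment ℝ P (P + dir θ x) → V k = P ∧ ℓ = x := fun he => by
      obtain ⟨h1, h2⟩ := segment_inj (hθ.dir_im_neg _) (hθ.dir_im_neg _) he
      exact ⟨h1, hθ.dir_injective h2⟩
    rcases u.hasLabels.mem_edges.1 hE with he | he | he | he <;> obtain ⟨h1, h2⟩ := hinj he
    · exact ⟨u.b, Or.inl ⟨h2.symm, rfl⟩, Or.inl h1⟩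
    · exact ⟨u.a, Or.inr ⟨rfl, h2.symm⟩, Or.inl h1⟩
    · exact ⟨u.a, Or.inr ⟨rfl, h2.symm⟩, Or.inr h1⟩
    · exact ⟨u.b, Or.inl ⟨h2.symm, rfl⟩, Or.inr h1⟩
  obtain ⟨b, hb, hV⟩ := hlab
  have hpb : 0 < height θ ℓ ε (dir θ b) := h.pos _ hb.ne.symm
  have hpq : 0 < height θ ℓ ε (dir θ (q k)) := h.pos _ (h.ne k hk)
  rcases hV with hV | hV
  -- `y` is small enough for the translate of the side by `y • dir θ b` to stay inside the slab of
  -- `t k`, hence in `t k`. That translate spans the full width of `t k`, so its start lies on the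
  -- edge in direction `q k`, which forces `b = q k`.
  · set y : ℝ := height θ ℓ ε (dir θ (q k)) /
      (height θ ℓ ε (dir θ (q k)) + height θ ℓ ε (dir θ b)) with hy
    have hy0 : 0 < y := by positivity
    have hy1 : y ≤ 1 := by rw [hy, div_le_one (by linarith)]; linarith
    have hyb : y * height θ ℓ ε (dir θ b) < height θ ℓ ε (dir θ (q k)) := by
      rw [hy, div_mul_eq_mul_div, div_lt_iff₀ (by linarith)]
      nlinarith
    have hin : ∀ r ∈ Set.Icc (0 : ℝ) 1, V k + r • dir θ ℓ + y • dir θ b ∈ (t k).carrier θ := by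
      intro r hr
      refine h.mem_of_height hk (hu (hb.mem_carrier.2 ⟨r, hr, y, ⟨hy0.le, hy1⟩, by rw [hV]⟩)) ?_ ?_
      · simp only [height_add, height_smul, height_self]
        nlinarith
      · rw [h.succ k hk]
        simp only [height_add, height_smul, height_self]
        linarith
    obtain ⟨r, hr, s, hs, e0⟩ := (h.labels k hk).mem_carrier.1 (hin 0 (by simp))
    obtain ⟨r', hr', s', hs', e1⟩ := (h.labels k hk).mem_carrier.1 (hin 1 (by simp))
    rw [h.apex k hk] at e0 e1
    have e2 : (1 - (r' - r)) • dir θ ℓ = (s' - s) • dir θ (q k) := by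
      linear_combination (norm := module) e1 - e0
    have hs2 : s' - s = 0 := by
      have := congrArg (cr (dir θ ℓ)) e2
      rw [cr_smul, cr_smul, cr_self, mul_zero, eq_comm, mul_eq_zero] at this
      exact this.resolve_right (hθ.cr_ne (h.ne k hk).symm)
    have hr2 : 1 - (r' - r) = 0 := by
      rw [hs2, zero_smul, smul_eq_zero] at e2
      exact e2.resolve_right (hθ.dir_ne_zero ℓ)
    have hr0 : r = 0 := by linarith [hr.1, hr'.2]
    rw [hr0] at e0
    have e3 : y • dir θ b = s • dir θ (q k) := by
      linear_combination (norm := module) e0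
    have hbq : b = q k := by
      by_contra hne
      have := congrArg (cr (dir θ (q k))) e3
      rw [cr_smul, cr_smul, cr_self, mul_zero, mul_eq_zero] at this
      exact this.elim hy0.ne' (hθ.cr_ne (Ne.symm hne))
    exact Tile.eq_of_hasLabels (hbq ▸ hb) (h.labels k hk) (by rw [h.apex k hk, hV])
  -- Here the side is the far edge of `u`, which then lies entirely behind it.
  · obtain ⟨z, hz, hlt⟩ := hz
    obtain ⟨r, hr, s, hs, rfl⟩ := hb.mem_carrier.1 hz
    rw [hV] at hlt
    simp only [height_add, height_smul, height_self] at hlt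
    nlinarith [hs.2]

lemma tile_mem (hθ : IsAdmissible θ) (h : Strip θ w ℓ ε m V q t) {T : Finset (Tile n)}
    (hT : IsRhombicTiling θ w T) (k : ℕ) (hk : k < m) : t k ∈ T := by
  induction k with
  | zero => exact key 0 hk (fun j hj => by omega)
  | succ k ih => exact key (k + 1) hk (fun j hj => by
      obtain rfl : j = k := by omega
      exact ih (by omega))
where
  key (k : ℕ) (hk : k < m) (hprev : ∀ j, j + 1 = k → t j ∈ T) : t k ∈ T := by
    have : Nonempty (Tile n) := ⟨t k⟩
    choose! u huT huz F hF hxF using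
      fun (x : ℝ) (hx : x ∈ Set.Ioo (0 : ℝ) 1) => h.exists_tile hθ hT hk hprev hx
    have hfin : {p : Tile n × Set ℂ | p.1 ∈ T ∧ p.2 ∈ p.1.edges θ}.Finite := by
      refine (T.finite_toSet.biUnion
        (t := fun v => (fun E => (v, E)) '' v.edges θ) fun v _ => (v.finite_edges θ).image _).subset
        ?_
      rintro ⟨v, E⟩ ⟨hv, hE⟩
      exact Set.mem_biUnion (x := v) hv ⟨E, hE, rfl⟩
    have hmaps : Set.MapsTo (fun x => (u x, F x)) (Set.Ioo 0 1)
        {p : Tile n × Set ℂ | p.1 ∈ T ∧ p.2 ∈ p.1.edges θ} :=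
      fun x hx => ⟨huT x hx, hF x hx⟩
    -- Pigeonhole: infinitely many points of the side, finitely many tile edges. An edge containing
    -- two of the points coincides with the side by discreteness.
    obtain ⟨x, hx, y, hy, hxy, he⟩ := (Set.Ioo_infinite (zero_lt_one' ℝ)).exists_ne_map_eq_of_mapsTo
      hmaps hfin
    simp only [Prod.mk.injEq] at he
    have hnt : (F x ∩ segment ℝ (V k) (V k + dir θ ℓ)).Nontrivial := by
      refine ⟨_, ⟨hxF x hx, mem_segment_add.2 ⟨x, Set.Ioo_subset_Icc_self hx, rfl⟩⟩, _,
        ⟨he.2 ▸ hxF y hy, mem_segment_add.2 ⟨y, Set.Ioo_subset_Icc_self hy, rfl⟩⟩, ?_⟩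
      intro hc
      exact hxy (smul_left_injective ℝ (hθ.dir_ne_zero ℓ) (add_left_cancel hc))
    have hFE : F x = segment ℝ (V k) (V k + dir θ ℓ) := by
      rcases k with _ | j
      · exact hT.discrete_boundary _ (huT x hx) _ (hF x hx) _ h.first hnt
      · exact hT.discrete _ (huT x hx) _ (hprev j rfl) _ (hF x hx) _ (h.edge_mem (by omega)) hnt
    have hsub : (u x).carrier θ ⊆ region θ w := by
      rw [← hT.cover]
      exact Set.subset_biUnion_of_mem (u := fun u : Tile n => u.carrier θ) (huT x hx)
    rw [← h.eq_tile hθ hk hsub (huz x hx) (hFE ▸ hF x hx)]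
    exact huT x hx

/-- The tiling of a strip is unique. -/
theorem mem_iff (hθ : IsAdmissible θ) (h : Strip θ w ℓ ε m V q t) {T : Finset (Tile n)}
    (hT : IsRhombicTiling θ w T) (u : Tile n) : u ∈ T ↔ ∃ k < m, u = t k := by
  constructor
  · intro hu
    -- The strip tiles already cover the region, so any further tile would have an interior point in
    -- one of them.
    obtain ⟨z, hz⟩ := u.interior_nonempty hθ
    have hr : z ∈ region θ w := by
      rw [← hT.cover]
      exact Set.mem_biUnion (x := u) hu (interior_subset hz)
    obtain ⟨k, hk, hzk⟩ := (h.mem_region z).1 hr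
    refine ⟨k, hk, ?_⟩
    by_contra hne
    exact Tile.notMem_interior hθ (hT.disjoint _ (h.tile_mem hθ hT k hk) _ hu (Ne.symm hne)) hzk hz
  · rintro ⟨k, hk, rfl⟩
    exact h.tile_mem hθ hT k hk

end Strip


/-! ### Perimeter tiles of a strip -/

namespace Strip

variable {n : ℕ} {θ : Fin n → ℝ} {w : Perm (Fin n)} {ℓ : Fin n} {ε : ℝ} {m : ℕ} {V : ℕ → ℂ}
  {q : ℕ → Fin n} {t : ℕ → Tile n}

lemma vertex_injective (h : Strip θ w ℓ ε m V q t) {i j : ℕ} (hi : i ≤ m) (hj : j ≤ m)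
    (he : V i = V j) : i = j := by
  rcases lt_trichotomy i j with hij | rfl | hij
  · exact absurd (h.height_lt hij hj) (by rw [he]; exact lt_irrefl _)
  · rfl
  · exact absurd (h.height_lt hij hi) (by rw [he]; exact lt_irrefl _)

/-- A tile of a strip is a perimeter tile if and only if it is at one of the two ends. -/
lemma isPerimeterTile_iff (hθ : IsAdmissible θ) (h : Strip θ w ℓ ε m V q t)
    (hside : ∀ k < m, k = 0 ∨ k + 1 = m →
      segment ℝ (V k) (V k + dir θ (q k)) ∈ polygonSides θ w)
    (hlast : segment ℝ (V m) (V m + dir θ ℓ) ∈ polygonSides θ w)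
    (hends : ∀ P, segment ℝ P (P + dir θ ℓ) ∈ polygonSides θ w → P = V 0 ∨ P = V m)
    {k : ℕ} (hk : k < m) : IsPerimeterTile θ w (t k) ↔ k = 0 ∨ k + 1 = m := by
  have hedge := fun E => (h.labels k hk).mem_edges (θ := θ) (E := E)
  simp only [h.apex k hk, ← h.succ k hk] at hedge
  have hne := (h.ne k hk).symm
  have hdir : dir θ ℓ ≠ dir θ (q k) := fun e => hne (hθ.dir_injective e)
  constructor
  · rintro ⟨E, hE, F, hF, hEF, ⟨z, hzE, hzF⟩, hEp, hFp⟩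
    have h0 : segment ℝ (V k) (V k + dir θ ℓ) ∈ polygonSides θ w → k = 0 ∨ k + 1 = m :=
      fun hp => by
        rcases hends _ hp with hV | hV
        · exact Or.inl (h.vertex_injective hk.le (by omega) hV)
        · exact absurd (h.vertex_injective hk.le le_rfl hV) hk.ne
    have h1 : segment ℝ (V (k + 1)) (V (k + 1) + dir θ ℓ) ∈ polygonSides θ w →
        k = 0 ∨ k + 1 = m := fun hp => by
      rcases hends _ hp with hV | hV
      · exact absurd (h.vertex_injective (by omega) (by omega) hV) (by omega)
      · exact Or.inr (h.vertex_injective (by omega) le_rfl hV)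
    -- The two edges not labeled `ℓ` are disjoint, so two meeting edges include one labeled `ℓ`; on
    -- the boundary such edges occur only at the ends.
    have hpar : ∀ z, z ∈ segment ℝ (V k) (V (k + 1)) →
        z ∉ segment ℝ (V k + dir θ ℓ) (V k + dir θ ℓ + dir θ (q k)) := by
      intro z hz hz'
      rw [h.succ k hk] at hz
      obtain ⟨r, -, hr⟩ := mem_segment_add.1 hz
      obtain ⟨s, -, hs⟩ := mem_segment_add.1 hz'
      have he : dir θ ℓ = (r - s) • dir θ (q k) := by
        linear_combination (norm := module) hr - hs
      have := congrArg (cr (dir θ (q k))) he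
      rw [cr_smul, cr_self, mul_zero] at this
      exact hθ.cr_ne hne.symm this
    rcases (hedge E).1 hE with rfl | rfl | rfl | rfl
    · exact h0 hEp
    · rcases (hedge F).1 hF with rfl | rfl | rfl | rfl
      · exact h0 hFp
      · exact absurd rfl hEF
      · exact absurd hzF (hpar z hzE)
      · exact h1 hFp
    · rcases (hedge F).1 hF with rfl | rfl | rfl | rfl
      · exact h0 hFp
      · exact absurd hzE (hpar z hzF)
      · exact absurd rfl hEF
      · exact h1 hFp
    · exact h1 hEp
  · intro hc
    have hs := hside k hk hc
    have hmem := (hedge _).2 (Or.inr (Or.inl rfl))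
    rw [h.succ k hk] at hmem
    rcases hc with rfl | rfl
    · refine ⟨_, (hedge _).2 (Or.inl rfl), _, hmem, ?_,
        ⟨_, left_mem_segment ℝ _ _, left_mem_segment ℝ _ _⟩, h.first, hs⟩
      intro hc
      exact hdir (segment_inj (hθ.dir_im_neg _) (hθ.dir_im_neg _) hc).2
    · refine ⟨_, (hedge _).2 (Or.inr (Or.inr (Or.inr rfl))), _, hmem, ?_,
        ⟨V (k + 1), left_mem_segment ℝ _ _, ?_⟩, hlast, hs⟩
      · intro hc
        exact hdir (segment_inj (hθ.dir_im_neg _) (hθ.dir_im_neg _) hc).2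
      · rw [h.succ k hk]
        exact right_mem_segment ℝ _ _

lemma perim_eq_two (hθ : IsAdmissible θ) (h : Strip θ w ℓ ε m V q t) (hm : 2 ≤ m)
    (hside : ∀ k < m, k = 0 ∨ k + 1 = m →
      segment ℝ (V k) (V k + dir θ (q k)) ∈ polygonSides θ w)
    (hlast : segment ℝ (V m) (V m + dir θ ℓ) ∈ polygonSides θ w)
    (hends : ∀ P, segment ℝ P (P + dir θ ℓ) ∈ polygonSides θ w → P = V 0 ∨ P = V m)
    {T : Finset (Tile n)} (hT : IsRhombicTiling θ w T) : perim θ w T = 2 := by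
  have hset : {u | u ∈ T ∧ IsPerimeterTile θ w u} = {t 0, t (m - 1)} := by
    ext u
    simp only [Set.mem_ofPred_eq, Set.mem_insert_iff, Set.mem_singleton_iff]
    rw [h.mem_iff hθ hT]
    constructor
    · rintro ⟨⟨k, hk, rfl⟩, hp⟩
      rcases (h.isPerimeterTile_iff hθ hside hlast hends hk).1 hp with rfl | hk'
      · exact Or.inl rfl
      · exact Or.inr (by rw [← hk', Nat.add_sub_cancel])
    · rintro (rfl | rfl)
      · exact ⟨⟨0, by omega, rfl⟩,
          (h.isPerimeterTile_iff hθ hside hlast hends (by omega)).2 (Or.inl rfl)⟩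
      · exact ⟨⟨m - 1, by omega, rfl⟩,
          (h.isPerimeterTile_iff hθ hside hlast hends (by omega)).2 (Or.inr (by omega))⟩
  rw [perim, hset, Set.ncard_pair]
  intro he
  have h1 := congrArg Tile.apex he
  rw [h.apex 0 (by omega), h.apex (m - 1) (by omega)] at h1
  have := h.vertex_injective (by omega) (by omega) h1
  omega

end Strip

/-! ### The exceptional polygons are strips -/

variable {n : ℕ} {θ : Fin n → ℝ}

/-- If one boundary path of the polygon starts with `ℓ`, the other one ends with `ℓ`, and the
other labels increase along both of them, then every tiling has two perimeter tiles. -/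
theorem perim_eq_two_of_strip (hn : 2 < n) (hθ : IsAdmissible θ) {w ρ ρ' : Perm (Fin n)}
    (hw : IsContiguous w) {ℓ first last : Fin n} (hfirst : first.val = 0)
    (hlast : last.val + 1 = n) {ε : ℝ} (hpos : ∀ b, b ≠ ℓ → 0 < ε * cr (dir θ ℓ) (dir θ b))
    (hsides : polygonSides θ w = Set.range (pathSide θ ρ) ∪ Set.range (pathSide θ ρ'))
    (hρ : ρ last = ℓ) (hρ' : ρ' first = ℓ)
    (hmono : ∀ x y, x ≠ ℓ → y ≠ ℓ → x < y → ρ.symm x < ρ.symm y)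
    (hwmono : ∀ x y, x ≠ ℓ → y ≠ ℓ → x < y → w.symm x < w.symm y)
    (hlt : ∀ b, ℓ < b → w.symm b < w.symm ℓ) (hgt : ∀ b, b < ℓ → w.symm ℓ < w.symm b)
    {T : Finset (Tile n)} (hT : IsRhombicTiling θ w T) : perim θ w T = 2 := by
  obtain ⟨T₀, hT₀⟩ := exists_sweep θ (one_weakLE w)
  have htil := Sweep.isRhombicTiling hn hθ hw (T := hT₀.finite.toFinset) (by simpa using hT₀)
  have hρlt : ∀ x, x ≠ ℓ → ρ.symm x < last := fun x hx => by
    have : ρ.symm x ≠ last := fun e => hx (by rw [← hρ, ← e, apply_symm_apply])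
    omega
  -- Every swept tile involves `ℓ`, since no other pair is inverted in `w`. On each path below `w`
  -- the other labels stand in the order of `ρ`, so the labels other than `ℓ` above the tile are
  -- those preceding `b` in `ρ`; `ℓ` itself is not above it.
  have hlab : ∀ u ∈ T₀, ∃ b, u.HasLabels ℓ b ∧ u.apex = pathVertex θ ρ (ρ.symm b).val := by
    intro u hu
    have hinv := (hT₀.inv_of_mem hu).2
    obtain ⟨σ, i, j, hij, hlt', -, hσw, rfl⟩ := hT₀.exists_of_mem hu
    have hσ : WeakLE σ w := (weakLE_flip hij hlt').trans hσw
    have hb : ∃ b, (flipTile θ σ i j hlt').HasLabels ℓ b := by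
      by_cases ha : σ i = ℓ
      · exact ⟨σ j, Or.inl ⟨ha, rfl⟩⟩
      by_cases hb : σ j = ℓ
      · exact ⟨σ i, Or.inr ⟨rfl, hb⟩⟩
      · exact absurd hinv (hwmono _ _ ha hb hlt').not_gt
    obtain ⟨b, hb⟩ := hb
    refine ⟨b, hb, ?_⟩
    have hσlt : ∀ x y, x ≠ ℓ → y ≠ ℓ → x < y → σ.symm x < σ.symm y := by
      intro x y hx hy hxy
      refine lt_of_le_of_ne (not_lt.1 fun hc => ?_) fun e => hxy.ne (σ.symm.injective e)
      exact (hwmono x y hx hy hxy).not_gt (hσ _ _ hxy hc)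
    have hcmp : ∀ x y, x ≠ ℓ → y ≠ ℓ → (σ.symm x < σ.symm y ↔ ρ.symm x < ρ.symm y) := by
      intro x y hx hy
      rcases lt_trichotomy x y with hxy | rfl | hxy
      · exact iff_of_true (hσlt _ _ hx hy hxy) (hmono _ _ hx hy hxy)
      · simp
      · exact iff_of_false (hσlt _ _ hy hx hxy).not_gt (hmono _ _ hy hx hxy).not_gt
    have hij' : (σ.symm ℓ = i ∧ σ.symm b = j) ∨ (σ.symm b = i ∧ σ.symm ℓ = j) := by
      rcases hb with ⟨h1, h2⟩ | ⟨h1, h2⟩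
      · exact Or.inl ⟨by rw [← h1]; simp [flipTile], by rw [← h2]; simp [flipTile]⟩
      · exact Or.inr ⟨by rw [← h1]; simp [flipTile], by rw [← h2]; simp [flipTile]⟩
    change pathVertex θ σ i.val = _
    rw [pathVertex_eq_sum, pathVertex_eq_sum]
    refine Finset.sum_congr rfl fun x _ => ?_
    have : (σ.symm x).val < i.val ↔ (ρ.symm x).val < (ρ.symm b).val := by
      by_cases hx : x = ℓ
      · subst hx
        have h1 := hρlt b hb.ne.symm
        have h2 : ρ.symm x = last := by rw [← hρ, symm_apply_apply]
        rw [h2]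
        rcases hij' with ⟨h3, h4⟩ | ⟨h3, h4⟩ <;> constructor <;> intro <;> omega
      · have hne : σ.symm x ≠ σ.symm ℓ := fun e => hx (σ.symm.injective e)
        have h1 := hcmp x b hx hb.ne.symm
        rw [Fin.lt_def, Fin.lt_def] at h1
        rw [← h1]
        rcases hij' with ⟨h3, h4⟩ | ⟨h3, h4⟩ <;> constructor <;> intro <;> omega
    simp only [this]
  -- The value `ℓ` for `k ≥ n` is never used: the strip has only `n - 1` tiles.
  set q : ℕ → Fin n := fun k => if h : k < n then ρ ⟨k, h⟩ else ℓ with hq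
  have hqk : ∀ (k : ℕ) (h : k < n), q k = ρ ⟨k, h⟩ := fun k h => by simp [hq, h]
  have hqne : ∀ k < n - 1, q k ≠ ℓ := fun k hk e => by
    rw [hqk k (by omega), ← hρ] at e
    have := ρ.injective e
    rw [Fin.ext_iff] at this
    simp only at this
    omega
  have hex : ∀ k < n - 1, ∃ u ∈ T₀, u.HasLabels ℓ (q k) := by
    intro k hk
    rcases lt_or_gt_of_ne (hqne k hk) with hc | hc
    · obtain ⟨u, hu, h1, h2⟩ := hT₀.exists_of_inv hc hc.not_gt (hgt _ hc)
      exact ⟨u, hu, Or.inr ⟨h1, h2⟩⟩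
    · obtain ⟨u, hu, h1, h2⟩ := hT₀.exists_of_inv hc hc.not_gt (hlt _ hc)
      exact ⟨u, hu, Or.inl ⟨h1, h2⟩⟩
  have hne : Nonempty (Tile n) := ⟨(hex 0 (by omega)).choose⟩
  choose! t ht htl using hex
  have hother : ∀ {u : Tile n} {x b : Fin n}, u.HasLabels ℓ x → u.HasLabels ℓ b → x = b := by
    rintro u x b (⟨h1, h2⟩ | ⟨h1, h2⟩) (⟨h3, h4⟩ | ⟨h3, h4⟩)
    · exact h2.symm.trans h4
    · exact absurd (h1.trans h4.symm) u.lt.ne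
    · exact absurd (h3.trans h2.symm) u.lt.ne
    · exact h1.symm.trans h3
  have hq_symm : ∀ k < n - 1, (ρ.symm (q k)).val = k := fun k hk => by
    rw [hqk k (by omega), symm_apply_apply]
  have hfirst' : pathSide θ ρ' first = segment ℝ 0 (0 + dir θ ℓ) := by
    rw [pathSide_eq, hfirst, hρ', pathVertex_zero]
  have hn1 : n - 1 = last.val := by omega
  have hstrip : Strip θ w ℓ ε (n - 1) (pathVertex θ ρ) q t := by
    refine ⟨hpos, hqne, fun k hk => ?_, fun k hk => ?_, htl, fun z => ?_, ?_⟩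
    · rw [hqk k (by omega)]
      exact pathVertex_succ θ ρ ⟨k, by omega⟩
    · obtain ⟨b, hb, hap⟩ := hlab _ (ht k hk)
      rw [hap, ← hother (htl k hk) hb, hq_symm k hk]
    · rw [← htil.cover]
      simp only [Set.mem_iUnion, Set.Finite.mem_toFinset, exists_prop]
      constructor
      · rintro ⟨u, hu, hz⟩
        obtain ⟨b, hb, hap⟩ := hlab u hu
        have hbl := hρlt b hb.ne.symm
        have hk : (ρ.symm b).val < n - 1 := by omega
        have hqb : q (ρ.symm b).val = b := by rw [hqk _ (ρ.symm b).2]; simp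
        obtain ⟨b', hb', hap'⟩ := hlab _ (ht _ hk)
        refine ⟨_, hk, ?_⟩
        have h1 := hother (htl _ hk) hb'
        rw [hqb] at h1
        subst h1
        have heq : u = t (ρ.symm b).val := Tile.eq_of_hasLabels hb hb' (hap.trans hap'.symm)
        exact heq ▸ hz
      · rintro ⟨k, hk, hz⟩
        exact ⟨t k, ht k hk, hz⟩
    · rw [pathVertex_zero, ← hfirst', hsides]
      exact Or.inr ⟨_, rfl⟩
  refine hstrip.perim_eq_two hθ (by omega) (fun k hk _ => ?_) ?_ (fun P hP => ?_) hT
  · rw [hqk k (by omega), hsides]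
    exact Or.inl ⟨⟨k, by omega⟩, pathSide_eq θ ρ _⟩
  · rw [hn1, ← hρ, hsides]
    exact Or.inl ⟨last, pathSide_eq θ ρ _⟩
  · rw [hsides] at hP
    rcases hP with ⟨i, hi⟩ | ⟨i, hi⟩ <;> rw [pathSide_eq] at hi <;>
      obtain ⟨h1, h2⟩ := segment_inj (hθ.dir_im_neg _) (hθ.dir_im_neg _) hi
    · have : i = last := ρ.injective ((hθ.dir_injective h2).trans hρ.symm)
      exact Or.inr (by rw [← h1, this, hn1])
    · have : i = first := ρ'.injective ((hθ.dir_injective h2).trans hρ'.symm)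
      exact Or.inl (by rw [← h1, this, hfirst, pathVertex_zero, pathVertex_zero])

/-- Here `ℓ` is the smallest label, first on the left path and last on the right one; all other
directions turn counterclockwise from it, so `ε = 1`. -/
lemma IsFirstLast.perim_eq_two (hn : 2 < n) (hθ : IsAdmissible θ) {w : Perm (Fin n)}
    (hw : IsContiguous w) (h : IsFirstLast w) {T : Finset (Tile n)}
    (hT : IsRhombicTiling θ w T) : perim θ w T = 2 := by
  set p : Fin n := ⟨0, by omega⟩
  set l : Fin n := ⟨n - 1, by omega⟩
  have hsymm : ∀ x : Fin n, (w.symm x).val = if x.val = 0 then n - 1 else x.val - 1 := by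
    intro x
    have := h (w.symm x)
    rw [apply_symm_apply] at this
    split_ifs at this ⊢ <;> omega
  have hmono : ∀ x y, x ≠ p → y ≠ p → x < y → w.symm x < w.symm y := by
    intro x y hx hy hxy
    have h1 : x.val ≠ 0 := fun e => hx (Fin.ext e)
    have h2 : y.val ≠ 0 := fun e => hy (Fin.ext e)
    rw [Fin.lt_def, hsymm, hsymm, if_neg h1, if_neg h2]
    omega
  refine perim_eq_two_of_strip hn hθ hw (ρ := w) (ρ' := 1) (ℓ := p) (first := p) (last := l)
    (ε := 1) rfl (by simp only [l]; omega) (fun b hb => ?_) (Set.union_comm _ _) ?_ rfl hmono hmono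
    (fun b hb => ?_) (fun b hb => ?_) hT
  · rw [one_mul]
    exact hθ.cr_pos (lt_of_le_of_ne (Fin.le_def.2 (Nat.zero_le _)) hb.symm)
  · apply Fin.ext
    rw [h, if_pos rfl]
  · have h1 : b.val ≠ 0 := by have := Fin.lt_def.1 hb; omega
    rw [Fin.lt_def, hsymm, hsymm, if_neg h1, if_pos rfl]
    omega
  · exact absurd (Fin.lt_def.1 hb) (Nat.not_lt_zero _)

/-- Here `ℓ` is the largest label, the two paths exchange roles, and all other directions turn
clockwise from it, so `ε = -1`. -/
lemma IsLastFirst.perim_eq_two (hn : 2 < n) (hθ : IsAdmissible θ) {w : Perm (Fin n)}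
    (hw : IsContiguous w) (h : IsLastFirst w) {T : Finset (Tile n)}
    (hT : IsRhombicTiling θ w T) : perim θ w T = 2 := by
  set p : Fin n := ⟨0, by omega⟩
  set l : Fin n := ⟨n - 1, by omega⟩
  have hle : ∀ b, b ≠ l → b < l := fun b hb =>
    lt_of_le_of_ne (Fin.le_def.2 (by simp only [l]; omega)) hb
  have hsymm : ∀ x : Fin n, (w.symm x).val = if x.val = n - 1 then 0 else x.val + 1 := by
    intro x
    have := h (w.symm x)
    rw [apply_symm_apply] at this
    split_ifs at this ⊢ <;> omega
  refine perim_eq_two_of_strip hn hθ hw (ρ := 1) (ρ' := w) (ℓ := l) (first := p) (last := l)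
    (ε := -1) rfl (by simp only [l]; omega) (fun b hb => ?_) rfl rfl ?_ (fun x y _ _ hxy => hxy)
    (fun x y hx hy hxy => ?_) (fun b hb => ?_) (fun b hb => ?_) hT
  · linarith [hθ.cr_neg (hle b hb)]
  · apply Fin.ext
    rw [h, if_pos rfl]
  · have h1 : x.val ≠ n - 1 := fun e => hx (Fin.ext e)
    have h2 : y.val ≠ n - 1 := fun e => hy (Fin.ext e)
    rw [Fin.lt_def, hsymm, hsymm, if_neg h1, if_neg h2]
    have := Fin.lt_def.1 hxy
    omega
  · have h1 := Fin.lt_def.1 hb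
    simp only [l] at h1
    omega
  · have h1 : b.val ≠ n - 1 := fun e => by
      have := Fin.lt_def.1 hb
      simp only [l] at this
      omega
    rw [Fin.lt_def, hsymm, hsymm, if_neg h1, if_pos rfl]
    omega

end

end Elnitsky

theorem mainTheorem3 (n : ℕ) (hn : 2 < n) (θ : Fin n → ℝ) (hθ : Elnitsky.IsAdmissible θ)
    (w : Equiv.Perm (Fin n)) (hw : Elnitsky.IsContiguous w) :
    (∀ T : Finset (Elnitsky.Tile n), Elnitsky.IsRhombicTiling θ w T → Elnitsky.perim θ w T = 2) ↔
      (Elnitsky.IsLastFirst w ∨ Elnitsky.IsFirstLast w) := by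
  constructor
  · intro h
    by_contra! hc
    obtain ⟨T, hT, hne⟩ := hw.exists_tiling hn hθ hc.1 hc.2
    exact hne (h T hT)
  · rintro (h | h) T hT
    exacts [h.perim_eq_two hn hθ hw hT, h.perim_eq_two hn hθ hw hT]
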